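/- Let $\mathbb S_\infty$ be the group of all finite permutations of $\mathbb N_0=\{0,1,2,\dots\}$, with Coxeter generators $\sigma_i=(i-1,i)$ and star generators $\gamma_i=(0,i)$ for $i\ge 1$, and $\sigma_0=\gamma_0=\mathrm{id}$. For $n\ge1$ let $\mathbb S_{n,\infty}$ be the subgroup generated by $\sigma_n,\sigma_{n+1},\dots$. Let $\mathrm{sh}$ be the endomorphism of $\mathbb S_\infty$ with $\mathrm{sh}(\sigma_i)=\sigma_{i+1}$ for $i\ge1$, and for $m\in\mathbb N_0$ put $\mathrm{sh}_m(\tau)=\sigma_m\sigma_{m-1}\cdots\sigma_0\,\mathrm{sh}(\tau)\,\sigma_0\cdots\sigma_{m-1}\sigma_m$. Let $\pi$ be a unitary representation of $\mathbb S_\infty$ on a separable complex Hilbert space $\mathcal H$, let $\mathcal A\subset\mathcal B(\mathcal H)$ be the von Neumann algebra generated by $\pi(\mathbb S_\infty)$, and put $u_i=\pi(\sigma_i)$, $v_i=\pi(\gamma_i)$. Let $\rho_0=\operatorname{Ad}\pi$ be the representation of $\mathbb S_\infty$ by automorphisms $x\mapsto\pi(\sigma)x\pi(\sigma)^*$ of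 $\mathcal A$, and for $n\in\mathbb N_0$ let $\mathcal A_{n-1}=\{x\in\mathcal A:\rho_0(\sigma)(x)=x\text{ for all }\sigma\in\mathbb S_{n+1,\infty}\}$. Let $\varphi$ be a faithful normal state on $\mathcal A$, let $\operatorname{Aut}(\mathcal A,\varphi)$ be the group of $\varphi$-preserving automorphisms of $\mathcal A$, and let $\mathcal A^\varphi=\{x\in\mathcal A:\varphi(xy)=\varphi(yx)\text{ for all }y\in\mathcal A\}$ be the centralizer of $\varphi$. A sequence $(x_n)_{n\ge0}$ in $\mathcal A$ is called exchangeable if there are a von Neumann algebra $\mathcal C$ with separable predual, a faithful normal state $\varphi_0$ on $\mathcal C$, an element $a\in\mathcal C$, and injective $*$-homomorphisms $\iota_n:\mathcal C\to\mathcal A$ ($n\in\mathbb N_0$) such that: $\varphi\circ\iota_n=\varphi_0$; each $\iota_n(\mathcal C)$ is a von Neumann subalgebra of $\mathcal A$ onto which a $\varphi$-preserving conditional expectation from $\mathcal A$ exists; for every $s\in\mathbb S_\infty$, every $k\in\mathbb N$, all $i_1,\dots,i_k\in\mathbb N_0$ and all $a_1,\dots,a_k\in\mathcal C$, $$\varphi\big(\iota_{i_1}(a_1)\cdots\iota_{i_k}(a_k)\big)=\varphi\big(\iota_{s(i_1)}(a_1)\cdots\iota_{s(i_k)}(a_k)\big);$$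 and $x_n=\iota_n(a)$ for all $n$. Then the following are equivalent: (a) $\rho_0(\mathbb S_\infty)\subset\operatorname{Aut}(\mathcal A,\varphi)$; (b) $\varphi$ is tracial; (c) the sequence $(v_1,v_2,v_3,\dots)$ is exchangeable and $v_1\in\mathcal A^\varphi$. If one (and thus all) of these conditions holds then, for each $n\in\mathbb N_0$, the limits $$\alpha_n(x)=\lim_{N\to\infty}\rho_0\big(\mathrm{sh}^n(\sigma_1\sigma_2\cdots\sigma_N)\big)(x)=\lim_{N\to\infty}(u_{n+1}u_{n+2}\cdots u_N)\,x\,(u_{n+1}u_{n+2}\cdots u_N)^*\qquad(x\in\mathcal A)$$ exist in the strong operator topology and define a unital $*$-endomorphism $\alpha_n$ of $\mathcal A$ which is $\varphi$-preserving. Moreover $\alpha_n$ has the fixed point algebra $\mathcal A^{\alpha_n}=\mathcal A_{n-1}$, and $\alpha_n\circ\pi=\pi\circ\mathrm{sh}_n$. In particular, for all $i\ge1$, $\alpha_0(u_i)=u_{i+1}$, and for all $n\ge1$ and $i\ge1$, $\alpha_n(v_i)=v_i$ if $i<n$ and $\alpha_n(v_i)=v_{i+1}$ if $i\ge n$. 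-/

import Mathlib

open Filter Topology
open scoped ComplexOrder InnerProductSpace

namespace InfSym

/-! ### The infinite symmetric group -/

/-- The infinite symmetric group: all permutations of `{0, 1, 2, …}` moving finitely many points. -/
def SInf : Subgroup (Equiv.Perm ℕ) where
  carrier := {s | {k | s k ≠ k}.Finite}
  one_mem' := by simp
  mul_mem' := by
    intro a b ha hb
    refine (Set.Finite.union ha hb).subset ?_
    intro k hk
    by_contra hcon
    simp only [Set.mem_union, Set.mem_ofPred_eq, not_or, not_not] at hcon
    exact hk (by simp [Equiv.Perm.mul_apply, hcon.1, hcon.2])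
  inv_mem' := by
    intro a ha
    refine Set.Finite.subset ha ?_
    intro k hk hcon
    exact hk (by rw [Equiv.Perm.inv_eq_iff_eq]; exact hcon.symm)

/-- Transpositions lie in the infinite symmetric group. -/
theorem swap_mem_SInf (i j : ℕ) : Equiv.swap i j ∈ SInf := by
  refine (Set.toFinite ({i, j} : Set ℕ)).subset ?_
  intro k hk
  by_contra hcon
  simp only [Set.mem_insert_iff, Set.mem_singleton_iff, not_or] at hcon
  exact hk (Equiv.swap_apply_of_ne_of_ne hcon.1 hcon.2)

/-- The Coxeter generators `σ_i = (i-1, i)` for `i ≥ 1`, and `σ_0 = id`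
(truncated subtraction makes `(0-1, 0)` the trivial transposition `(0, 0)`). -/
def cox (i : ℕ) : SInf := ⟨Equiv.swap (i - 1) i, swap_mem_SInf _ _⟩

/-- The star generators `γ_i = (0, i)` for `i ≥ 1`, and `γ_0 = id`. -/
def starGen (i : ℕ) : SInf := ⟨Equiv.swap 0 i, swap_mem_SInf _ _⟩

theorem cox_zero : cox 0 = 1 := by
  apply Subtype.ext
  simp [cox]
  rfl

theorem starGen_zero : starGen 0 = 1 := by
  apply Subtype.ext
  simp [starGen]
  rfl

/-- The subgroup `S_{n,∞} = ⟨σ_n, σ_{n+1}, …⟩` (used for `n ≥ 1`). -/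
def SFrom (n : ℕ) : Subgroup SInf := Subgroup.closure {s | ∃ k, n ≤ k ∧ s = cox k}

/-- The embedding `k ↦ k + 1` of `{0, 1, 2, …}` into itself. -/
def succEmb : ℕ ↪ ℕ := ⟨Nat.succ, Nat.succ_injective⟩

theorem viaSucc_mem_SInf (s : SInf) :
    Equiv.Perm.viaEmbeddingHom succEmb (s : Equiv.Perm ℕ) ∈ SInf := by
  have hs : {k | (s : Equiv.Perm ℕ) k ≠ k}.Finite := s.2
  refine (hs.image succEmb).subset ?_
  intro k hk
  rcases k with _ | k
  · exact absurd (Equiv.Perm.viaEmbedding_apply_of_notMem (s : Equiv.Perm ℕ) succEmb 0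
      (by rintro ⟨j, hj⟩; exact Nat.succ_ne_zero j hj)) hk
  · refine ⟨k, ?_, rfl⟩
    intro hcon
    apply hk
    have h := Equiv.Perm.viaEmbedding_apply (s : Equiv.Perm ℕ) succEmb k
    rw [hcon] at h
    exact h

/-- The shift endomorphism `sh` of `S_∞`: `sh(s)` fixes `0` and maps `k + 1` to `s(k) + 1`. -/
noncomputable def sh : SInf →* SInf :=
  ((Equiv.Perm.viaEmbeddingHom succEmb).comp SInf.subtype).codRestrict SInf viaSucc_mem_SInf

theorem sh_apply_zero (s : SInf) : (sh s : Equiv.Perm ℕ) 0 = 0 :=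
  Equiv.Perm.viaEmbedding_apply_of_notMem (s : Equiv.Perm ℕ) succEmb 0
    (by rintro ⟨j, hj⟩; exact Nat.succ_ne_zero j hj)

theorem sh_apply_succ (s : SInf) (k : ℕ) :
    (sh s : Equiv.Perm ℕ) (k + 1) = (s : Equiv.Perm ℕ) k + 1 :=
  Equiv.Perm.viaEmbedding_apply (s : Equiv.Perm ℕ) succEmb k

/-- `sh` is the symbolic shift on the Coxeter generators. -/
theorem sh_cox (i : ℕ) (hi : 1 ≤ i) : sh (cox i) = cox (i + 1) := by
  obtain ⟨j, rfl⟩ : ∃ j, i = j + 1 := ⟨i - 1, by omega⟩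
  apply Subtype.ext
  ext k
  rcases k with _ | k
  · rw [sh_apply_zero]
    simp only [cox, Nat.add_sub_cancel]
    rw [Equiv.swap_apply_of_ne_of_ne] <;> omega
  · rw [sh_apply_succ]
    simp only [cox, Nat.add_sub_cancel, Equiv.swap_apply_def]
    split_ifs <;> omega

/-- The product `σ_m σ_{m-1} ⋯ σ_1 σ_0`. -/
def coxDown (m : ℕ) : SInf := ((List.range (m + 1)).reverse.map cox).prod

/-- The product `σ_{a} σ_{a+1} ⋯ σ_{b}` (the identity if `b < a`). -/
def coxUp (a b : ℕ) : SInf := ((List.Ico a (b + 1)).map cox).prod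

/-- The partial shift `sh_m(τ) = (σ_m ⋯ σ_1 σ_0) sh(τ) (σ_0 σ_1 ⋯ σ_m)`; the right factor is the
inverse of the left one. -/
noncomputable def partialSh (m : ℕ) : SInf →* SInf :=
  (MulAut.conj (coxDown m)).toMonoidHom.comp sh

theorem coxDown_inv (m : ℕ) : (coxDown m)⁻¹ = coxUp 0 m := by
  have hinv : ∀ i, (cox i)⁻¹ = cox i := by
    intro i
    apply Subtype.ext
    simp [cox]
  rw [coxDown, List.prod_inv_reverse, coxUp, List.map_map, ← List.map_reverse,
    List.reverse_reverse, List.Ico.zero_bot]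
  congr 1

theorem partialSh_apply (m : ℕ) (s : SInf) :
    partialSh m s = coxDown m * sh s * coxUp 0 m := by
  rw [← coxDown_inv]
  rfl

/-! ### Von Neumann algebras and states -/

universe u

section Algebras

variable {H : Type u} [NormedAddCommGroup H] [InnerProductSpace ℂ H] [CompleteSpace H]

/-- The von Neumann algebra generated by a set `S` of bounded operators: the double commutant
of `S ∪ S*` (`StarSubalgebra.centralizer` is the commutant of the set together with its adjoints). -/
noncomputable def vN (S : Set (H →L[ℂ] H)) : VonNeumannAlgebra H where
  toStarSubalgebra := StarSubalgebra.centralizer ℂ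
    ((StarSubalgebra.centralizer ℂ S : StarSubalgebra ℂ (H →L[ℂ] H)) : Set (H →L[ℂ] H))
  centralizer_centralizer' := by
    change Set.centralizer (Set.centralizer (StarSubalgebra.centralizer ℂ
      ((StarSubalgebra.centralizer ℂ S : StarSubalgebra ℂ (H →L[ℂ] H)) :
        Set (H →L[ℂ] H)) : Set (H →L[ℂ] H))) = (StarSubalgebra.centralizer ℂ
      ((StarSubalgebra.centralizer ℂ S : StarSubalgebra ℂ (H →L[ℂ] H)) :
        Set (H →L[ℂ] H)) : Set (H →L[ℂ] H))
    rw [StarSubalgebra.coe_centralizer_centralizer]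
    simp

/-- The generating set is contained in the generated von Neumann algebra. -/
theorem subset_vN (S : Set (H →L[ℂ] H)) {x : H →L[ℂ] H} (hx : x ∈ S) :
    x ∈ (vN S).toStarSubalgebra := by
  change x ∈ StarSubalgebra.centralizer ℂ
    ((StarSubalgebra.centralizer ℂ S : StarSubalgebra ℂ (H →L[ℂ] H)) : Set (H →L[ℂ] H))
  rw [StarSubalgebra.mem_centralizer_iff]
  intro g hg
  have h1 := (StarSubalgebra.mem_centralizer_iff ℂ).1 hg x hx
  have h2 := (StarSubalgebra.mem_centralizer_iff ℂ).1 (star_mem hg) x hx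
  exact ⟨h1.1.symm, h2.1.symm⟩

/-- A linear functional on a von Neumann algebra `A ⊆ B(H)` is normal if it is ultraweakly
continuous, i.e. belongs to the predual of `A`: it has the form `x ↦ ∑ ⟨ξ_n, x η_n⟩` with
`∑ ‖ξ_n‖² < ∞` and `∑ ‖η_n‖² < ∞`. -/
def IsNormal (A : VonNeumannAlgebra H) (φ : A.toStarSubalgebra →ₗ[ℂ] ℂ) : Prop :=
  ∃ ξ η : ℕ → H, Summable (fun n => ‖ξ n‖ ^ 2) ∧ Summable (fun n => ‖η n‖ ^ 2) ∧
    ∀ x : A.toStarSubalgebra, HasSum (fun n => ⟪ξ n, (x : H →L[ℂ] H) (η n)⟫_ℂ) (φ x)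

/-- `φ` is a faithful normal state on the von Neumann algebra `A`. -/
structure IsFaithfulNormalState (A : VonNeumannAlgebra H)
    (φ : A.toStarSubalgebra →ₗ[ℂ] ℂ) : Prop where
  map_one : φ 1 = 1
  nonneg : ∀ x, 0 ≤ φ (star x * x)
  faithful : ∀ x, φ (star x * x) = 0 → x = 0
  normal : IsNormal A φ

/-- `φ` is tracial. -/
def IsTracial (A : VonNeumannAlgebra H) (φ : A.toStarSubalgebra →ₗ[ℂ] ℂ) : Prop :=
  ∀ x y, φ (x * y) = φ (y * x)

/-- The (underlying set of the) centralizer `A^φ` of the state `φ`. -/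
def stateCentralizer (A : VonNeumannAlgebra H) (φ : A.toStarSubalgebra →ₗ[ℂ] ℂ) :
    Set A.toStarSubalgebra :=
  {x | ∀ y, φ (x * y) = φ (y * x)}

/-- `Aut(A, φ)`: the `φ`-preserving automorphisms of `A`. -/
def autState (A : VonNeumannAlgebra H) (φ : A.toStarSubalgebra →ₗ[ℂ] ℂ) :
    Subgroup (A.toStarSubalgebra ≃⋆ₐ[ℂ] A.toStarSubalgebra) where
  carrier := {θ | ∀ x, φ (θ x) = φ x}
  one_mem' := fun _ => rfl
  mul_mem' := fun {a b} ha hb x => (ha (b x)).trans (hb x)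
  inv_mem' := fun {a} ha x => by
    have h := ha (a⁻¹ x)
    rw [← h]
    exact congrArg φ (a.apply_symm_apply x)

/-- The von Neumann subalgebra `B` of `A` is `φ`-conditioned: there is a `φ`-preserving conditional
expectation `E` (a positive `B`-bimodule projection) from `A` onto `B`. -/
def IsConditioned (A : VonNeumannAlgebra H) (φ : A.toStarSubalgebra →ₗ[ℂ] ℂ)
    (B : VonNeumannAlgebra H) : Prop :=
  B ≤ A ∧ ∃ E : A.toStarSubalgebra →ₗ[ℂ] A.toStarSubalgebra,
    (∀ x, (E x : H →L[ℂ] H) ∈ B) ∧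
    (∀ b : A.toStarSubalgebra, (b : H →L[ℂ] H) ∈ B → E b = b) ∧
    (∀ b x c : A.toStarSubalgebra, (b : H →L[ℂ] H) ∈ B → (c : H →L[ℂ] H) ∈ B →
      E (b * x * c) = b * E x * c) ∧
    (∀ x, 0 ≤ ((E (star x * x) : A.toStarSubalgebra) : H →L[ℂ] H)) ∧
    (∀ x, φ (E x) = φ x)

end Algebras

/-! ### Random sequences and exchangeability -/

section Random

variable {H : Type u} [NormedAddCommGroup H] [InnerProductSpace ℂ H] [CompleteSpace H]
  {K : Type u} [NormedAddCommGroup K] [InnerProductSpace ℂ K] [CompleteSpace K]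

/-- `ι` is a random variable from `(C, φ₀)` to `(A, φ)`: an injective `*`-homomorphism with
`φ₀ = φ ∘ ι` whose range is a `φ`-conditioned von Neumann subalgebra of `A`. (Such an `ι` is
automatically unital, as `φ` is faithful and `φ (ι 1) = φ₀ 1 = 1`.) -/
structure IsRandomVariable (C : VonNeumannAlgebra K) (φ₀ : C.toStarSubalgebra →ₗ[ℂ] ℂ)
    (A : VonNeumannAlgebra H) (φ : A.toStarSubalgebra →ₗ[ℂ] ℂ)
    (ι : C.toStarSubalgebra →⋆ₐ[ℂ] A.toStarSubalgebra) : Prop where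
  injective : Function.Injective ι
  state_eq : ∀ c, φ₀ c = φ (ι c)
  conditioned : ∃ B : VonNeumannAlgebra H,
    (B : Set (H →L[ℂ] H)) = Set.range (fun c => (ι c : H →L[ℂ] H)) ∧ IsConditioned A φ B

/-- Two sequences of `*`-homomorphisms have the same distribution: all their multilinear
functionals `φ (ι_{i(1)}(a_1) ⋯ ι_{i(n)}(a_n))` coincide. -/
def SameDistribution {C : VonNeumannAlgebra K}
    {A : VonNeumannAlgebra H} (φ : A.toStarSubalgebra →ₗ[ℂ] ℂ)
    (ι κ : ℕ → (C.toStarSubalgebra →⋆ₐ[ℂ] A.toStarSubalgebra)) : Prop :=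
  ∀ (n : ℕ) (i : Fin n → ℕ) (a : Fin n → C.toStarSubalgebra),
    φ (List.ofFn fun k => ι (i k) (a k)).prod = φ (List.ofFn fun k => κ (i k) (a k)).prod

/-- A random sequence is exchangeable if its distribution is invariant under all finite
permutations of the index set `{0, 1, 2, …}`. -/
def IsExchangeable {C : VonNeumannAlgebra K}
    {A : VonNeumannAlgebra H} (φ : A.toStarSubalgebra →ₗ[ℂ] ℂ)
    (ι : ℕ → (C.toStarSubalgebra →⋆ₐ[ℂ] A.toStarSubalgebra)) : Prop :=
  ∀ s : SInf, SameDistribution φ ι (fun n => ι ((s : Equiv.Perm ℕ) n))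

/-- A sequence of operators `x_0, x_1, …` in `(A, φ)` is exchangeable if it is induced by an
exchangeable random sequence: `x_n = ι_n(a)` for some exchangeable random sequence `(ι_n)` from a
probability space `(C, φ₀)` (a von Neumann algebra with separable predual, realised on a separable
Hilbert space, and a faithful normal state) to `(A, φ)` and some `a ∈ C`. -/
def IsExchangeableOps (A : VonNeumannAlgebra H) (φ : A.toStarSubalgebra →ₗ[ℂ] ℂ)
    (x : ℕ → A.toStarSubalgebra) : Prop :=
  ∃ (K : Type u) (_ : NormedAddCommGroup K) (_ : InnerProductSpace ℂ K) (_ : CompleteSpace K)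
    (_ : TopologicalSpace.SeparableSpace K)
    (C : VonNeumannAlgebra K) (φ₀ : C.toStarSubalgebra →ₗ[ℂ] ℂ)
    (ι : ℕ → (C.toStarSubalgebra →⋆ₐ[ℂ] A.toStarSubalgebra)) (a : C.toStarSubalgebra),
    IsFaithfulNormalState C φ₀ ∧ (∀ n, IsRandomVariable C φ₀ A φ (ι n)) ∧
      IsExchangeable φ ι ∧ ∀ n, ι n a = x n

/-- Convergence of a sequence in `A ⊆ B(H)` in the strong operator topology. -/
def SOTTendsto {A : VonNeumannAlgebra H} (x : ℕ → A.toStarSubalgebra)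
    (y : A.toStarSubalgebra) : Prop :=
  ∀ h : H, Tendsto (fun N => (x N : H →L[ℂ] H) h) atTop (𝓝 ((y : H →L[ℂ] H) h))

end Random

/-! ### Unitary representations of the infinite symmetric group -/

section Rep

variable {H : Type u} [NormedAddCommGroup H] [InnerProductSpace ℂ H] [CompleteSpace H]

/-- The von Neumann algebra `A = vN(π(S_∞))`. -/
noncomputable def repAlg (π : SInf →* unitary (H →L[ℂ] H)) : VonNeumannAlgebra H :=
  vN (Set.range fun s => (π s : H →L[ℂ] H))

/-- The elements of `A = vN(π(S_∞))`. -/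
abbrev Alg (π : SInf →* unitary (H →L[ℂ] H)) : Type u := (repAlg π).toStarSubalgebra

/-- The representation `π`, viewed as a homomorphism into the unitaries of `A`. -/
noncomputable def repU (π : SInf →* unitary (H →L[ℂ] H)) : SInf →* unitary (Alg π) where
  toFun s := ⟨⟨(π s : H →L[ℂ] H), subset_vN _ ⟨s, rfl⟩⟩, by
    rw [Unitary.mem_iff]
    exact ⟨Subtype.ext (Unitary.coe_star_mul_self (π s)),
      Subtype.ext (Unitary.coe_mul_star_self (π s))⟩⟩
  map_one' := by
    apply Subtype.ext
    apply Subtype.ext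
    simp
  map_mul' s t := by
    apply Subtype.ext
    apply Subtype.ext
    simp

/-- The operator `π(s)` as an element of `A`. -/
noncomputable def rep (π : SInf →* unitary (H →L[ℂ] H)) (s : SInf) : Alg π := (repU π s : Alg π)

theorem coe_rep (π : SInf →* unitary (H →L[ℂ] H)) (s : SInf) :
    (rep π s : H →L[ℂ] H) = (π s : H →L[ℂ] H) := rfl

/-- The represented Coxeter generators `u_i = π(σ_i)`. -/
noncomputable def coxU (π : SInf →* unitary (H →L[ℂ] H)) (i : ℕ) : Alg π := rep π (cox i)

/-- The represented star generators `v_i = π(γ_i)`. -/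
noncomputable def starV (π : SInf →* unitary (H →L[ℂ] H)) (i : ℕ) : Alg π := rep π (starGen i)

/-- The representation `ρ₀ = Ad π` of `S_∞` by automorphisms of `A`. -/
noncomputable def AdRep (π : SInf →* unitary (H →L[ℂ] H)) : SInf →* (Alg π ≃⋆ₐ[ℂ] Alg π) :=
  (Unitary.conjStarAlgAut ℂ (Alg π)).comp (repU π)

theorem AdRep_apply (π : SInf →* unitary (H →L[ℂ] H)) (s : SInf) (x : Alg π) :
    AdRep π s x = rep π s * x * star (rep π s) := rfl

/-- `Ad (u_a u_{a+1} ⋯ u_b)` applied to `x` (the identity if `b < a`). -/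
noncomputable def AdCox (π : SInf →* unitary (H →L[ℂ] H)) (a b : ℕ) (x : Alg π) : Alg π :=
  ((List.Ico a (b + 1)).map (coxU π)).prod * x * star ((List.Ico a (b + 1)).map (coxU π)).prod

/-- The fixed point algebra `A_{n-1} = A^{ρ₀(S_{n+1,∞})}`, for `n = 0, 1, 2, …`. -/
noncomputable def fixAlgPred (π : SInf →* unitary (H →L[ℂ] H)) (n : ℕ) :
    StarSubalgebra ℂ (Alg π) :=
  ⨅ s ∈ SFrom (n + 1), StarAlgHom.equalizer (AdRep π s : Alg π →⋆ₐ[ℂ] Alg π)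
    (StarAlgHom.id ℂ (Alg π))

/-- The fixed point algebra `A^α` of an endomorphism `α` of `A`. -/
noncomputable def endoFix {π : SInf →* unitary (H →L[ℂ] H)} (α : Alg π →⋆ₐ[ℂ] Alg π) :
    StarSubalgebra ℂ (Alg π) :=
  StarAlgHom.equalizer α (StarAlgHom.id ℂ (Alg π))

theorem mem_fixAlgPred (π : SInf →* unitary (H →L[ℂ] H)) (n : ℕ) (x : Alg π) :
    x ∈ fixAlgPred π n ↔ ∀ s ∈ SFrom (n + 1), AdRep π s x = x := by
  simp [fixAlgPred, StarSubalgebra.mem_iInf]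

end Rep

end InfSym

set_option linter.unusedSectionVars false

/-! Two mechanisms carry the theorem: normal functionals on the algebra are determined by their
values on `π(S_∞)`, and conjugation in `S_∞` is eventually stationary along the products `σ_{n+1} ⋯
σ_N`.

The first is von Neumann's density theorem on `ℓ²(ℕ, H)` (`exists_span_approx`,
`IsNormal.eq_of_rep`). Invariance of `φ` under `Ad π(s)` says `φ(π(s) y) = φ(y π(s))`; for fixed `y`
both sides are values of normal functionals at `π(s)`, so `φ` is a trace. The converse is immediate.

A trace yields (c): put `C = span {1, v_1}` and let `ι_n` be conjugation by `π(sh γ_n)`. Since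
`sh(s) γ_{i+1} sh(s)⁻¹ = γ_{s(i)+1}`, the invariance of `φ` gives exchangeability. The conditional
expectation onto `span {1, v_i}` is the compression to the spectral projections `(1 ± v_i)/2`.
Conversely every `π(t)` is a word in the `v_i`, so exchangeability makes `φ` invariant under `Ad
π(sh s)`. The centralizer condition adds invariance under `Ad v_1`, and `γ_1` together with
`sh(S_∞)` generates `S_∞`.

For the limits, `Ad π(σ_{n+1} ⋯ σ_N)` is eventually constant on the span of `π(S_∞)`. This span is
dense for the seminorm `φ(x* x)^{1/2}`, which every `Ad π(s)` preserves. So the orbit of each `x` is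
bounded and Cauchy in this seminorm, hence strongly convergent because `φ` is faithful and normal
(`IsFaithfulNormalState.tendsto_zero_of_stateSq`).

A fixed point of `α_n` is in the range of every power of `α_n`. Since `sh_n^k(t)` fixes `n, …,
n+k-1`, that range commutes with any prescribed `u_b`, `b > n`, once `k` is large. -/

namespace InfSym

section Operators

variable {H : Type u} [NormedAddCommGroup H] [InnerProductSpace ℂ H] [CompleteSpace H]

/-! ### Amplification and von Neumann's density theorem -/

/-- The Hilbert space `ℓ²(ℕ, H)`. -/
abbrev EllTwo (H : Type u) [NormedAddCommGroup H] : Type u := lp (fun _ : ℕ => H) 2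

/-- An `ℓ²`-summable sequence as a vector of `ℓ²(ℕ, H)`. -/
def EllTwo.ofSummable (ζ : ℕ → H) (hζ : Summable fun n => ‖ζ n‖ ^ 2) : EllTwo H :=
  ⟨ζ, memℓp_gen (by simpa using hζ)⟩

theorem EllTwo.summable_sq (ζ : EllTwo H) : Summable fun n => ‖ζ n‖ ^ 2 := by
  simpa using (lp.memℓp ζ).summable (by norm_num)

theorem EllTwo.norm_sq (ζ : EllTwo H) : ‖ζ‖ ^ 2 = ∑' n, ‖ζ n‖ ^ 2 := by
  simpa using lp.norm_rpow_eq_tsum (p := 2) (by norm_num) ζ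

theorem summable_sq_apply (T : H →L[ℂ] H) {ζ : ℕ → H} (hζ : Summable fun n => ‖ζ n‖ ^ 2) :
    Summable fun n => ‖T (ζ n)‖ ^ 2 := by
  refine Summable.of_nonneg_of_le (fun n => by positivity) (fun n => ?_) (hζ.mul_left (‖T‖ ^ 2))
  rw [← mul_pow]
  gcongr
  exact T.le_opNorm _

/-- The amplification `1 ⊗ T` of an operator to `ℓ²(ℕ, H)`. -/
noncomputable def ampl (T : H →L[ℂ] H) : EllTwo H →L[ℂ] EllTwo H :=
  LinearMap.mkContinuous
    { toFun := fun ζ => EllTwo.ofSummable (fun n => T (ζ n)) (summable_sq_apply T ζ.summable_sq)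
      map_add' := fun a b => by
        apply lp.ext
        funext n
        exact map_add T _ _
      map_smul' := fun c a => by
        apply lp.ext
        funext n
        exact map_smul T _ _ } ‖T‖ (fun ζ => by
      refine le_of_sq_le_sq ?_ (by positivity)
      rw [mul_pow, EllTwo.norm_sq, EllTwo.norm_sq, ← tsum_mul_left]
      refine Summable.tsum_le_tsum (fun n => ?_) (EllTwo.summable_sq _)
        (ζ.summable_sq.mul_left _)
      rw [← mul_pow]
      exact pow_le_pow_left₀ (norm_nonneg _) (T.le_opNorm _) 2)

theorem ampl_apply (T : H →L[ℂ] H) (ζ : EllTwo H) (n : ℕ) : ampl T ζ n = T (ζ n) := rfl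

theorem ampl_single (T : H →L[ℂ] H) (n : ℕ) (h : H) :
    ampl T (lp.single 2 n h) = lp.single 2 n (T h) := by
  apply lp.ext
  funext k
  rw [ampl_apply]
  by_cases hk : k = n
  · subst hk
    simp
  · simp [hk]

theorem ampl_inner (T : H →L[ℂ] H) (a b : EllTwo H) :
    ⟪ampl T a, b⟫_ℂ = ⟪a, ampl (star T) b⟫_ℂ := by
  rw [lp.inner_eq_tsum, lp.inner_eq_tsum]
  congr 1
  funext n
  rw [ampl_apply, ampl_apply, ContinuousLinearMap.star_eq_adjoint,
    ContinuousLinearMap.adjoint_inner_right]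

/-- Evaluation of the amplification of an operator at a fixed vector. -/
noncomputable def amplAt (ζ : EllTwo H) : (H →L[ℂ] H) →ₗ[ℂ] EllTwo H where
  toFun T := ampl T ζ
  map_add' _ _ := by
    apply lp.ext
    funext n
    rfl
  map_smul' _ _ := by
    apply lp.ext
    funext n
    rfl

/-- The matrix entries of an operator on `ℓ²(ℕ, H)`. -/
noncomputable def matrixEntry (P : EllTwo H →L[ℂ] EllTwo H) (i j : ℕ) : H →L[ℂ] H :=
  (lp.evalCLM ℂ (fun _ : ℕ => H) 2 i).comp
    (P.comp (lp.singleContinuousLinearMap ℂ (fun _ : ℕ => H) 2 j))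

theorem matrixEntry_apply (P : EllTwo H →L[ℂ] EllTwo H) (i j : ℕ) (h : H) :
    matrixEntry P i j h = P (lp.single 2 j h) i := rfl

theorem hasSum_matrixEntry (P : EllTwo H →L[ℂ] EllTwo H) (ζ : EllTwo H) (i : ℕ) :
    HasSum (fun j => matrixEntry P i j (ζ j)) (P ζ i) :=
  ((lp.hasSum_single (by norm_num) ζ).mapL P).mapL (lp.evalCLM ℂ (fun _ : ℕ => H) 2 i)

/-- An operator commuting with the commutant of `S` has an amplification commuting with the
commutant of the amplification of `S`. -/
theorem ampl_comm_of_comm {S : Set (H →L[ℂ] H)} {x : H →L[ℂ] H}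
    (hx : ∀ g : H →L[ℂ] H, (∀ s ∈ S, g * s = s * g) → g * x = x * g)
    (P : EllTwo H →L[ℂ] EllTwo H) (hP : ∀ s ∈ S, ∀ ζ, P (ampl s ζ) = ampl s (P ζ))
    (ζ : EllTwo H) : P (ampl x ζ) = ampl x (P ζ) := by
  apply lp.ext
  funext i
  -- Each matrix entry of `P` commutes with `S`, so by hypothesis it commutes with `x`.
  have h : ∀ i j, ∀ h, matrixEntry P i j (x h) = x (matrixEntry P i j h) := by
    intro i j h
    refine DFunLike.congr_fun (hx (matrixEntry P i j) fun s hs => ?_) h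
    ext k
    change matrixEntry P i j (s k) = s (matrixEntry P i j k)
    rw [matrixEntry_apply, matrixEntry_apply, ← ampl_single, hP s hs, ampl_apply]
  refine (hasSum_matrixEntry P (ampl x ζ) i).unique ?_
  have := (hasSum_matrixEntry P ζ i).mapL x
  rw [ampl_apply]
  convert this using 2 with j
  rw [ampl_apply, h]

/-- Invariance of `W` under the adjoint `T'` makes the orthogonal complement invariant under `T`, so
`T` respects the decomposition. -/
theorem starProjection_comm_of_invariant {K : Type*} [NormedAddCommGroup K]
    [InnerProductSpace ℂ K] (W : Submodule ℂ K) [W.HasOrthogonalProjection] (T T' : K →L[ℂ] K)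
    (hadj : ∀ a b, ⟪T a, b⟫_ℂ = ⟪a, T' b⟫_ℂ) (hT : ∀ w ∈ W, T w ∈ W) (hT' : ∀ w ∈ W, T' w ∈ W)
    (ζ : K) : W.starProjection (T ζ) = T (W.starProjection ζ) := by
  refine Submodule.eq_starProjection_of_mem_of_inner_eq_zero
    (hT _ (Submodule.starProjection_apply_mem _ _)) fun w hw => ?_
  rw [← map_sub, hadj]
  exact Submodule.starProjection_inner_eq_zero _ _ (hT' w hw)

/-- Von Neumann's density theorem, for a set of operators closed under products and adjoints. -/
theorem exists_span_approx {S : Set (H →L[ℂ] H)} (h1 : 1 ∈ S) (hmul : ∀ a ∈ S, ∀ b ∈ S, a * b ∈ S)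
    (hstar : ∀ a ∈ S, star a ∈ S) {x : H →L[ℂ] H}
    (hx : ∀ g : H →L[ℂ] H, (∀ s ∈ S, g * s = s * g) → g * x = x * g)
    {ζ : ℕ → H} (hζ : Summable fun n => ‖ζ n‖ ^ 2) {ε : ℝ} (hε : 0 < ε) :
    ∃ m ∈ Submodule.span ℂ S, ∑' n, ‖(x - m) (ζ n)‖ ^ 2 < ε := by
  -- The whole sequence `ζ` becomes one vector `z`. The projection onto the closed cyclic subspace
  -- `W` of `z` commutes with the amplified `S`, hence with the amplified `x`; as `z` lies in `W`,
  -- so does its image under `x`.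
  set z := EllTwo.ofSummable ζ hζ
  set W₀ := (Submodule.span ℂ S).map (amplAt z)
  set W := W₀.topologicalClosure with hW
  have : CompleteSpace W := W₀.isClosed_topologicalClosure.completeSpace_coe
  have hinv : ∀ s ∈ S, ∀ w ∈ W, ampl s w ∈ W := by
    intro s hs w hw
    have h0 : ∀ w ∈ W₀, ampl s w ∈ W₀ := by
      rintro _ ⟨m, hm, rfl⟩
      refine ⟨s * m, ?_, rfl⟩
      have hle : Submodule.span ℂ S ≤ (Submodule.span ℂ S).comap (LinearMap.mulLeft ℂ s) := by
        rw [Submodule.span_le]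
        intro b hb
        exact Submodule.subset_span (hmul s hs b hb)
      exact hle hm
    exact map_mem_closure (ampl s).continuous hw h0
  have hP : ∀ s ∈ S, ∀ η, W.starProjection (ampl s η) = ampl s (W.starProjection η) :=
    fun s hs η => starProjection_comm_of_invariant W (ampl s) (ampl (star s)) (ampl_inner s)
      (hinv s hs) (hinv _ (hstar s hs)) η
  have hz : z ∈ W := W₀.le_topologicalClosure ⟨1, Submodule.subset_span h1, by
    apply lp.ext
    funext n
    rfl⟩
  have hxz : ampl x z ∈ W := by
    have := ampl_comm_of_comm hx W.starProjection hP z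
    rw [Submodule.starProjection_eq_self_iff.2 hz] at this
    rw [← this]
    exact Submodule.starProjection_apply_mem _ _
  obtain ⟨_, ⟨m, hm, rfl⟩, hd⟩ := Metric.mem_closure_iff.1 hxz (Real.sqrt ε) (Real.sqrt_pos.2 hε)
  refine ⟨m, hm, ?_⟩
  have hs := (Real.lt_sqrt dist_nonneg).1 hd
  have e : amplAt z x - amplAt z m = amplAt z (x - m) := (map_sub _ _ _).symm
  rw [dist_eq_norm, show ampl x z = amplAt z x from rfl, e, EllTwo.norm_sq] at hs
  exact hs

/-! ### Weak limits of bounded families -/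

/-- Each matrix coefficient stays in a compact disc and so converges along an ultrafilter. The
limits form a sesquilinear form bounded by `C`, which the Riesz theorem represents by an operator.
-/
theorem exists_weak_limit {ι : Type*} (U : Ultrafilter ι) (y : ι → H →L[ℂ] H) (C : ℝ)
    (hy : ∀ i, ‖y i‖ ≤ C) :
    ∃ T : H →L[ℂ] H, ∀ h k, Tendsto (fun i => ⟪y i h, k⟫_ℂ) U (𝓝 ⟪T h, k⟫_ℂ) := by
  have hb : ∀ i h k, ‖⟪y i h, k⟫_ℂ‖ ≤ C * ‖h‖ * ‖k‖ := fun i h k =>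
    (norm_inner_le_norm _ _).trans (by gcongr; exact (y i).le_of_opNorm_le (hy i) h)
  have hlim : ∀ h k, ∃ c : ℂ, ‖c‖ ≤ C * ‖h‖ * ‖k‖ ∧
      Tendsto (fun i => ⟪y i h, k⟫_ℂ) U (𝓝 c) := by
    intro h k
    obtain ⟨c, hc, hlim⟩ := (isCompact_closedBall (0 : ℂ) (C * ‖h‖ * ‖k‖)).ultrafilter_le_nhds
      (U.map fun i => ⟪y i h, k⟫_ℂ) (by
        rw [Filter.le_principal_iff]
        exact Filter.mem_map.2 (Filter.Eventually.of_forall fun i => by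
          simpa using hb i h k))
    exact ⟨c, by simpa using hc, hlim⟩
  choose f hf hlim using hlim
  let B : H →L⋆[ℂ] H →L[ℂ] ℂ := LinearMap.mkContinuous₂
    (LinearMap.mk₂'ₛₗ (starRingEnd ℂ) (RingHom.id ℂ) f
      (fun a b k => tendsto_nhds_unique (hlim _ _) <| by
        simpa only [map_add, inner_add_left] using (hlim a k).add (hlim b k))
      (fun c a k => tendsto_nhds_unique (hlim _ _) <| by
        simpa only [map_smul, inner_smul_left, smul_eq_mul] using (hlim a k).const_mul _)
      (fun a b k => tendsto_nhds_unique (hlim _ _) <| by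
        simpa only [inner_add_right] using (hlim a b).add (hlim a k))
      (fun c a k => tendsto_nhds_unique (hlim _ _) <| by
        simpa only [inner_smul_right, RingHom.id_apply, smul_eq_mul]
          using (hlim a k).const_mul _)) C hf
  refine ⟨InnerProductSpace.continuousLinearMapOfBilin B, fun h k => ?_⟩
  rw [InnerProductSpace.continuousLinearMapOfBilin_apply]
  exact hlim h k

/-- A weak limit of operators commuting with `g` commutes with `g`. -/
theorem comm_of_weak_limit {ι : Type*} {l : Filter ι} [l.NeBot] {y : ι → H →L[ℂ] H}
    {T g : H →L[ℂ] H} (hT : ∀ h k, Tendsto (fun i => ⟪y i h, k⟫_ℂ) l (𝓝 ⟪T h, k⟫_ℂ))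
    (hg : ∀ i, g * y i = y i * g) : g * T = T * g := by
  ext h
  refine ext_inner_right ℂ fun k => ?_
  refine tendsto_nhds_unique ?_ (hT (g h) k)
  change Tendsto _ _ (𝓝 ⟪g (T h), k⟫_ℂ)
  rw [← ContinuousLinearMap.adjoint_inner_right]
  refine (hT h _).congr fun i => ?_
  rw [ContinuousLinearMap.adjoint_inner_right]
  exact congrArg (fun v => ⟪v, k⟫_ℂ) (DFunLike.congr_fun (hg i) h)

end Operators

section NormalFunctionals

variable {H : Type u} [NormedAddCommGroup H] [InnerProductSpace ℂ H] [CompleteSpace H]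

/-! ### Membership in von Neumann algebras -/

theorem mem_of_comm_commutant {A : VonNeumannAlgebra H} {x : H →L[ℂ] H}
    (hx : ∀ g : H →L[ℂ] H, (∀ a ∈ A.toStarSubalgebra, g * a = a * g) → g * x = x * g) :
    x ∈ A.toStarSubalgebra := by
  change x ∈ (A : Set (H →L[ℂ] H))
  rw [← A.centralizer_centralizer]
  intro g hg
  exact hx g fun a ha => (hg a ha).symm

theorem comm_of_mem_vN {S : Set (H →L[ℂ] H)} {x : H →L[ℂ] H}
    (hx : x ∈ (vN S).toStarSubalgebra) {g : H →L[ℂ] H}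
    (hg : ∀ s ∈ S, g * s = s * g) (hg' : ∀ s ∈ S, g * star s = star s * g) : g * x = x * g := by
  have h : x ∈ StarSubalgebra.centralizer ℂ
    ((StarSubalgebra.centralizer ℂ S : StarSubalgebra ℂ (H →L[ℂ] H)) : Set (H →L[ℂ] H)) := hx
  exact ((StarSubalgebra.mem_centralizer_iff ℂ).1 h g ((StarSubalgebra.mem_centralizer_iff ℂ).2
    fun s hs => ⟨(hg s hs).symm, (hg' s hs).symm⟩)).1

/-- A von Neumann algebra is closed under bounded weak limits. -/
theorem mem_of_weak_limit {A : VonNeumannAlgebra H} {ι : Type*} {l : Filter ι} [l.NeBot]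
    {y : ι → A.toStarSubalgebra} {T : H →L[ℂ] H}
    (hT : ∀ h k, Tendsto (fun i => ⟪(y i : H →L[ℂ] H) h, k⟫_ℂ) l (𝓝 ⟪T h, k⟫_ℂ)) :
    T ∈ A.toStarSubalgebra :=
  mem_of_comm_commutant fun _ hg => comm_of_weak_limit hT fun i => hg _ (y i).2

/-! ### Normal functionals -/

/-- The interleaving of two sequences. -/
def interleave {X : Type*} (a b : ℕ → X) (n : ℕ) : X := if n % 2 = 0 then a (n / 2) else b (n / 2)

theorem interleave_even {X : Type*} (a b : ℕ → X) (k : ℕ) : interleave a b (2 * k) = a k := by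
  simp [interleave]

theorem interleave_odd {X : Type*} (a b : ℕ → X) (k : ℕ) : interleave a b (2 * k + 1) = b k := by
  rw [interleave, if_neg (by omega), show (2 * k + 1) / 2 = k by omega]

theorem summable_interleave {a b : ℕ → H} (ha : Summable fun n => ‖a n‖ ^ 2)
    (hb : Summable fun n => ‖b n‖ ^ 2) : Summable fun n => ‖interleave a b n‖ ^ 2 := by
  refine (HasSum.even_add_odd (m := ∑' n, ‖a n‖ ^ 2) (m' := ∑' n, ‖b n‖ ^ 2) ?_ ?_).summable
  · simpa only [interleave_even] using ha.hasSum
  · simpa only [interleave_odd] using hb.hasSum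

variable {A : VonNeumannAlgebra H}

/-- The two vector series are interleaved into one, with the sign absorbed into the left vectors. -/
theorem IsNormal.sub {φ ψ : A.toStarSubalgebra →ₗ[ℂ] ℂ} (hφ : IsNormal A φ) (hψ : IsNormal A ψ) :
    IsNormal A (φ - ψ) := by
  obtain ⟨ξ, η, hξ, hη, h⟩ := hφ
  obtain ⟨ξ', η', hξ', hη', h'⟩ := hψ
  refine ⟨interleave ξ fun n => -ξ' n, interleave η η',
    summable_interleave hξ (by simpa using hξ'), summable_interleave hη hη', fun x => ?_⟩
  rw [LinearMap.sub_apply, sub_eq_add_neg]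
  refine HasSum.even_add_odd ?_ ?_
  · simpa only [interleave_even] using h x
  · simpa only [interleave_odd, inner_neg_left] using (h' x).neg

theorem IsNormal.mul_left_right {φ : A.toStarSubalgebra →ₗ[ℂ] ℂ} (hφ : IsNormal A φ)
    (a b : A.toStarSubalgebra) :
    IsNormal A (φ ∘ₗ LinearMap.mulLeft ℂ a ∘ₗ LinearMap.mulRight ℂ b) := by
  obtain ⟨ξ, η, hξ, hη, h⟩ := hφ
  refine ⟨fun n => star (a : H →L[ℂ] H) (ξ n), fun n => (b : H →L[ℂ] H) (η n),
    summable_sq_apply _ hξ, summable_sq_apply _ hη, fun x => ?_⟩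
  refine (h (a * (x * b))).congr_fun ?_
  intro n
  rw [ContinuousLinearMap.star_eq_adjoint, ContinuousLinearMap.adjoint_inner_left]
  rfl

/-- Normal functionals are continuous along bounded weakly convergent families. -/
theorem IsNormal.tendsto {φ : A.toStarSubalgebra →ₗ[ℂ] ℂ} (hφ : IsNormal A φ) {ι : Type*}
    {l : Filter ι} {y : ι → A.toStarSubalgebra} {T : A.toStarSubalgebra} {C : ℝ}
    (hC : ∀ i, ‖(y i : H →L[ℂ] H)‖ ≤ C)
    (hT : ∀ h k, Tendsto (fun i => ⟪(y i : H →L[ℂ] H) h, k⟫_ℂ) l (𝓝 ⟪(T : H →L[ℂ] H) h, k⟫_ℂ)) :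
    Tendsto (fun i => φ (y i)) l (𝓝 (φ T)) := by
  obtain ⟨ξ, η, hξ, hη, h⟩ := hφ
  simp_rw [← (h _).tsum_eq]
  refine tendsto_tsum_of_dominated_convergence ((hξ.add hη).mul_left C) (fun n => ?_)
    (Eventually.of_forall fun i n => ?_)
  · simpa only [RCLike.star_def, inner_conj_symm] using (hT (η n) (ξ n)).star
  · have hC0 : 0 ≤ C := (norm_nonneg _).trans (hC i)
    calc ‖⟪ξ n, (y i : H →L[ℂ] H) (η n)⟫_ℂ‖ ≤ ‖ξ n‖ * (C * ‖η n‖) :=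
          (norm_inner_le_norm _ _).trans (by
            gcongr
            exact ContinuousLinearMap.le_of_opNorm_le _ (hC i) _)
      _ ≤ C * (‖ξ n‖ ^ 2 + ‖η n‖ ^ 2) := by
          have : ‖ξ n‖ * ‖η n‖ ≤ ‖ξ n‖ ^ 2 + ‖η n‖ ^ 2 := by
            nlinarith [sq_nonneg (‖ξ n‖ - ‖η n‖), sq_nonneg ‖ξ n‖, sq_nonneg ‖η n‖]
          nlinarith

/-! ### The seminorm of a positive functional -/

/-- The quadratic form `x ↦ φ(x* x)`. -/
noncomputable def stateSq (φ : A.toStarSubalgebra →ₗ[ℂ] ℂ) (x : A.toStarSubalgebra) : ℝ :=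
  (φ (star x * x)).re

/-- Polarization gives `Re ⟪xξ, xη⟫ ≤ ‖x(ξ + η)‖²`, so the vectors `ξ_n + η_n` dominate `φ(x* x)`
without putting `φ` in the form `∑ ⟪ζ_n, x ζ_n⟫`. This turns strong approximation into approximation
for the seminorm of `φ`. -/
theorem IsNormal.exists_stateSq_le {φ : A.toStarSubalgebra →ₗ[ℂ] ℂ} (hφ : IsNormal A φ) :
    ∃ ζ : ℕ → H, (Summable fun n => ‖ζ n‖ ^ 2) ∧
      ∀ x : A.toStarSubalgebra, stateSq φ x ≤ ∑' n, ‖(x : H →L[ℂ] H) (ζ n)‖ ^ 2 := by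
  obtain ⟨ξ, η, hξ, hη, h⟩ := hφ
  have hζ : Summable fun n => ‖ξ n + η n‖ ^ 2 := by
    refine Summable.of_nonneg_of_le (fun n => by positivity) (fun n => ?_)
      ((hξ.add hη).mul_left 2)
    have := parallelogram_law_with_norm ℂ (ξ n) (η n)
    nlinarith [norm_nonneg (ξ n - η n)]
  refine ⟨fun n => ξ n + η n, hζ, fun x => ?_⟩
  have h1 := Complex.hasSum_re (h (star x * x))
  refine hasSum_le (fun n => ?_) h1 (summable_sq_apply (x : H →L[ℂ] H) hζ).hasSum
  have e : ⟪ξ n, ((star x * x : A.toStarSubalgebra) : H →L[ℂ] H) (η n)⟫_ℂ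
      = ⟪(x : H →L[ℂ] H) (ξ n), (x : H →L[ℂ] H) (η n)⟫_ℂ := by
    rw [← ContinuousLinearMap.adjoint_inner_right]
    rfl
  rw [e, map_add]
  have h2 := norm_add_sq (𝕜 := ℂ) ((x : H →L[ℂ] H) (ξ n)) ((x : H →L[ℂ] H) (η n))
  rw [RCLike.re_to_complex] at h2
  have h3 := norm_sub_sq (𝕜 := ℂ) ((x : H →L[ℂ] H) (ξ n)) ((x : H →L[ℂ] H) (η n))
  rw [RCLike.re_to_complex] at h3
  nlinarith [sq_nonneg ‖(x : H →L[ℂ] H) (ξ n) - (x : H →L[ℂ] H) (η n)‖,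
    sq_nonneg ‖(x : H →L[ℂ] H) (ξ n) + (x : H →L[ℂ] H) (η n)‖]

namespace IsFaithfulNormalState

variable {φ : A.toStarSubalgebra →ₗ[ℂ] ℂ} (hφ : IsFaithfulNormalState A φ)
include hφ

theorem stateSq_nonneg (x : A.toStarSubalgebra) : 0 ≤ stateSq φ x :=
  (Complex.nonneg_iff.1 (hφ.nonneg x)).1

theorem coe_stateSq (x : A.toStarSubalgebra) : (stateSq φ x : ℂ) = φ (star x * x) :=
  Complex.ext rfl (Complex.nonneg_iff.1 (hφ.nonneg x)).2

theorem eq_zero_of_stateSq (x : A.toStarSubalgebra) (h : stateSq φ x = 0) : x = 0 := by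
  refine hφ.faithful x ?_
  rw [← hφ.coe_stateSq, h, Complex.ofReal_zero]

/-- Parallelogram law with one term dropped. The factors 2 account for the `ε / 4` in later
approximations. -/
theorem stateSq_add_le (x y : A.toStarSubalgebra) :
    stateSq φ (x + y) ≤ 2 * stateSq φ x + 2 * stateSq φ y := by
  have h : stateSq φ (x + y) + stateSq φ (x - y) = 2 * stateSq φ x + 2 * stateSq φ y := by
    simp only [stateSq, star_add, star_sub, add_mul, mul_add, sub_mul, mul_sub, map_add, map_sub,
      Complex.add_re, Complex.sub_re]
    ring
  linarith [hφ.stateSq_nonneg (x - y)]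

theorem stateSq_sub_le (x y : A.toStarSubalgebra) :
    stateSq φ (x - y) ≤ 2 * stateSq φ x + 2 * stateSq φ y := by
  have h := hφ.stateSq_add_le x (-y)
  rwa [← sub_eq_add_neg, show stateSq φ (-y) = stateSq φ y by simp [stateSq]] at h

/-- A bounded family converging to zero in the seminorm of a faithful normal state converges
strongly to zero. -/
theorem tendsto_zero_of_stateSq {ι : Type*} {l : Filter ι} {x : ι → A.toStarSubalgebra} {C : ℝ}
    (hC : ∀ i, ‖(x i : H →L[ℂ] H)‖ ≤ C) (hx : Tendsto (fun i => stateSq φ (x i)) l (𝓝 0)) (h : H) :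
    Tendsto (fun i => (x i : H →L[ℂ] H) h) l (𝓝 0) := by
  -- Along an ultrafilter the bounded family `x_i* x_i` has a weak limit `T ≥ 0`; normality gives
  -- `φ(T) = 0`, and it remains to see that `T = 0`.
  rw [tendsto_iff_ultrafilter]
  intro U hU
  have hb : ∀ i, ‖((star (x i) * x i : A.toStarSubalgebra) : H →L[ℂ] H)‖ ≤ C * C := fun i => by
    have h0 : ‖star (x i : H →L[ℂ] H) * (x i : H →L[ℂ] H)‖ ≤ C * C := by
      rw [CStarRing.norm_star_mul_self]
      exact mul_self_le_mul_self (norm_nonneg _) (hC i)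
    exact h0
  obtain ⟨T, hT⟩ := exists_weak_limit U
    (fun i => ((star (x i) * x i : A.toStarSubalgebra) : H →L[ℂ] H)) (C * C) hb
  have e : ∀ i h, ⟪((star (x i) * x i : A.toStarSubalgebra) : H →L[ℂ] H) h, h⟫_ℂ
      = ((‖(x i : H →L[ℂ] H) h‖ ^ 2 : ℝ) : ℂ) := fun i h => by
    have h1 := inner_self_eq_norm_sq_to_K (𝕜 := ℂ) ((x i : H →L[ℂ] H) h)
    rw [← ContinuousLinearMap.adjoint_inner_left] at h1
    refine Eq.trans ?_ (h1.trans (Complex.ofReal_pow _ _).symm)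
    rfl
  have hTA : T ∈ A.toStarSubalgebra := mem_of_weak_limit (l := (U : Filter ι)) hT
  have hTpos : 0 ≤ T := by
    rw [ContinuousLinearMap.nonneg_iff_isPositive, ContinuousLinearMap.isPositive_iff_complex]
    intro k
    have h0 : (0 : ℂ) ≤ ⟪T k, k⟫_ℂ := by
      refine ge_of_tendsto (hT k k) (Eventually.of_forall fun i => ?_)
      rw [e]
      exact Complex.zero_le_real.2 (sq_nonneg _)
    obtain ⟨h1, h2⟩ := Complex.nonneg_iff.1 h0
    exact ⟨Complex.ext rfl h2, h1⟩
  have hφT : φ ⟨T, hTA⟩ = 0 := by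
    refine tendsto_nhds_unique (hφ.normal.tendsto (l := (U : Filter ι)) hb
      (T := ⟨T, hTA⟩) hT) ?_
    simp_rw [← hφ.coe_stateSq]
    exact (Complex.continuous_ofReal.tendsto 0).comp (hx.mono_left hU)
  -- Faithfulness applies to elements `s* s` with `s` in the algebra. The square root of `T` is such
  -- an `s`, because the functional calculus of `T` commutes with everything that commutes with `T`.
  have hs : CFC.sqrt T * CFC.sqrt T = T := CFC.sqrt_mul_sqrt_self T hTpos
  have hsA : CFC.sqrt T ∈ A.toStarSubalgebra := by
    refine mem_of_comm_commutant fun g hg => ?_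
    rw [CFC.sqrt_eq_cfc]
    exact ((show Commute T g from (hg T hTA).symm).cfc_nnreal NNReal.sqrt).symm
  have hsa : star (CFC.sqrt T) = CFC.sqrt T := (CFC.sqrt_nonneg T).isSelfAdjoint.star_eq
  have hs0 : (⟨CFC.sqrt T, hsA⟩ : A.toStarSubalgebra) = 0 := by
    refine hφ.faithful _ ?_
    rw [← hφT]
    congr 1
    apply Subtype.ext
    change star (CFC.sqrt T) * CFC.sqrt T = T
    rw [hsa, hs]
  have hT0 : T = 0 := by
    rw [← hs, show CFC.sqrt T = 0 from congrArg Subtype.val hs0, mul_zero]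
  have h3 := hT h h
  simp only [e, hT0, zero_apply, inner_zero_left] at h3
  have h4 : Tendsto (fun i => ‖(x i : H →L[ℂ] H) h‖ ^ 2) U (𝓝 0) :=
    (Complex.continuous_re.tendsto 0).comp h3
  rw [tendsto_zero_iff_norm_tendsto_zero]
  simpa using h4.sqrt

end IsFaithfulNormalState

end NormalFunctionals

/-! ### Density of the linear span of the group in the algebra it generates. -/

section RepDensity

variable {H : Type u} [NormedAddCommGroup H] [InnerProductSpace ℂ H] [CompleteSpace H]
  (π : SInf →* unitary (H →L[ℂ] H))

theorem rep_mul (s t : SInf) : rep π (s * t) = rep π s * rep π t := by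
  simp [rep]

theorem rep_one : rep π 1 = 1 := by
  simp [rep]

theorem star_rep (s : SInf) : star (rep π s) = rep π s⁻¹ := by
  rw [rep, rep, map_inv]
  rfl

theorem star_rep_mul_rep (s : SInf) : star (rep π s) * rep π s = 1 := by
  rw [star_rep, ← rep_mul, inv_mul_cancel, rep_one]

theorem rep_mul_star_rep (s : SInf) : rep π s * star (rep π s) = 1 := by
  rw [star_rep, ← rep_mul, mul_inv_cancel, rep_one]

theorem AdRep_rep (s t : SInf) : AdRep π s (rep π t) = rep π (s * t * s⁻¹) := by
  rw [AdRep_apply, star_rep, rep_mul, rep_mul]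

/-- The linear span of `π(S_∞)` in the von Neumann algebra it generates. -/
noncomputable def repSpan : Submodule ℂ (Alg π) := Submodule.span ℂ (Set.range (rep π))

theorem exists_repSpan_approx (x : Alg π) {ζ : ℕ → H} (hζ : Summable fun n => ‖ζ n‖ ^ 2) {ε : ℝ}
    (hε : 0 < ε) : ∃ m ∈ repSpan π, ∑' n, ‖((x - m : Alg π) : H →L[ℂ] H) (ζ n)‖ ^ 2 < ε := by
  have hstar : ∀ s, star (π s : H →L[ℂ] H) = π s⁻¹ := fun s => by
    rw [map_inv]
    rfl
  obtain ⟨m, hm, h⟩ := exists_span_approx (S := Set.range fun s => (π s : H →L[ℂ] H))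
    ⟨1, by simp⟩
    (by rintro _ ⟨s, rfl⟩ _ ⟨t, rfl⟩; exact ⟨s * t, by simp⟩)
    (by rintro _ ⟨s, rfl⟩; exact ⟨s⁻¹, (hstar s).symm⟩)
    (x := (x : H →L[ℂ] H))
    (fun g hg => comm_of_mem_vN x.2 hg (by
      rintro _ ⟨s, rfl⟩
      rw [hstar]
      exact hg _ ⟨s⁻¹, rfl⟩)) hζ hε
  have e : Submodule.span ℂ (Set.range fun s => (π s : H →L[ℂ] H))
      = (repSpan π).map (repAlg π).toStarSubalgebra.toSubalgebra.val.toLinearMap := by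
    rw [repSpan, Submodule.map_span, ← Set.range_comp]
    rfl
  rw [e] at hm
  obtain ⟨m', hm', rfl⟩ := hm
  exact ⟨m', hm', h⟩

/-- The vectors that dominate the seminorm depend only on `φ`, so the density theorem can be applied
along them. -/
theorem IsNormal.exists_stateSq_sub_lt {φ : Alg π →ₗ[ℂ] ℂ} (hφ : IsNormal (repAlg π) φ)
    (x : Alg π) {ε : ℝ} (hε : 0 < ε) : ∃ m ∈ repSpan π, stateSq φ (x - m) < ε := by
  obtain ⟨ζ, hζ, h⟩ := hφ.exists_stateSq_le
  obtain ⟨m, hm, h'⟩ := exists_repSpan_approx π x hζ hε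
  exact ⟨m, hm, (h _).trans_lt h'⟩

/-- A normal functional vanishing on `π(S_∞)` vanishes. -/
theorem IsNormal.eq_zero_of_rep {ψ : Alg π →ₗ[ℂ] ℂ} (hψ : IsNormal (repAlg π) ψ)
    (h0 : ∀ s, ψ (rep π s) = 0) (x : Alg π) : ψ x = 0 := by
  obtain ⟨ξ, η, hξ, hη, h⟩ := hψ
  have hm0 : ∀ m ∈ repSpan π, ψ m = 0 := by
    have : repSpan π ≤ LinearMap.ker ψ := by
      rw [repSpan, Submodule.span_le]
      rintro _ ⟨s, rfl⟩
      exact h0 s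
    exact fun m hm => this hm
  set X := EllTwo.ofSummable ξ hξ
  -- Subtracting an `m` from the span does not change `ψ x`. Then `ψ (x - m)` is a single inner
  -- product in `ℓ²(ℕ, H)`, and Cauchy–Schwarz applies.
  have hle : ∀ ε : ℝ, 0 < ε → ‖ψ x‖ ≤ ‖X‖ * ε := by
    intro ε hε
    obtain ⟨m, hm, hlt⟩ := exists_repSpan_approx π x hη (pow_pos hε 2)
    set Y := ampl ((x - m : Alg π) : H →L[ℂ] H) (EllTwo.ofSummable η hη)
    have e : ψ x = ⟪X, Y⟫_ℂ := by
      have : ψ x = ψ (x - m) := by rw [map_sub, hm0 m hm, sub_zero]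
      rw [this]
      exact (h _).unique (lp.hasSum_inner X Y)
    have hY : ‖Y‖ ≤ ε := by
      refine (abs_le_of_sq_le_sq' ?_ hε.le).2
      rw [EllTwo.norm_sq]
      exact hlt.le
    rw [e]
    exact (norm_inner_le_norm _ _).trans (by gcongr)
  refine norm_eq_zero.1 (le_antisymm (le_of_forall_pos_le_add fun ε hε => ?_) (norm_nonneg _))
  refine (hle (ε / (‖X‖ + 1)) (by positivity)).trans ?_
  rw [zero_add, mul_div_assoc', div_le_iff₀ (by positivity)]
  nlinarith [norm_nonneg X]

/-- Normal functionals agreeing on `π(S_∞)` agree. -/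
theorem IsNormal.eq_of_rep {ψ ψ' : Alg π →ₗ[ℂ] ℂ} (hψ : IsNormal (repAlg π) ψ)
    (hψ' : IsNormal (repAlg π) ψ') (h : ∀ s, ψ (rep π s) = ψ' (rep π s)) (x : Alg π) :
    ψ x = ψ' x :=
  sub_eq_zero.1 ((hψ.sub hψ').eq_zero_of_rep π (fun s => sub_eq_zero.2 (h s)) x)

end RepDensity

section LimitEndomorphism

variable {H : Type u} [NormedAddCommGroup H] [InnerProductSpace ℂ H] [CompleteSpace H]

/-! ### Strong limits -/

theorem SOTTendsto.unique {A : VonNeumannAlgebra H} {x : ℕ → A.toStarSubalgebra}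
    {y z : A.toStarSubalgebra} (hy : SOTTendsto x y) (hz : SOTTendsto x z) : y = z :=
  Subtype.ext (ContinuousLinearMap.ext fun h => tendsto_nhds_unique (hy h) (hz h))

theorem SOTTendsto.weak {A : VonNeumannAlgebra H} {x : ℕ → A.toStarSubalgebra}
    {y : A.toStarSubalgebra} (hy : SOTTendsto x y) (h k : H) :
    Tendsto (fun i => ⟪(x i : H →L[ℂ] H) h, k⟫_ℂ) atTop (𝓝 ⟪(y : H →L[ℂ] H) h, k⟫_ℂ) :=
  (hy h).inner tendsto_const_nhds

theorem SOTTendsto.of_eventually_eq {A : VonNeumannAlgebra H} {x : ℕ → A.toStarSubalgebra}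
    {y : A.toStarSubalgebra} (hy : ∀ᶠ n in atTop, x n = y) : SOTTendsto x y := fun h =>
  tendsto_const_nhds.congr' (hy.mono fun n hn => by simp only [hn])

theorem SOTTendsto.add {A : VonNeumannAlgebra H} {x x' : ℕ → A.toStarSubalgebra}
    {y y' : A.toStarSubalgebra} (h : SOTTendsto x y) (h' : SOTTendsto x' y') :
    SOTTendsto (fun n => x n + x' n) (y + y') := fun k => (h k).add (h' k)

theorem SOTTendsto.mul {A : VonNeumannAlgebra H} {x x' : ℕ → A.toStarSubalgebra}
    {y y' : A.toStarSubalgebra} {C : ℝ} (hC : ∀ n, ‖(x n : H →L[ℂ] H)‖ ≤ C)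
    (h : SOTTendsto x y) (h' : SOTTendsto x' y') :
    SOTTendsto (fun n => x n * x' n) (y * y') := by
  intro k
  change Tendsto (fun n => (x n : H →L[ℂ] H) ((x' n : H →L[ℂ] H) k)) _
    (𝓝 ((y : H →L[ℂ] H) ((y' : H →L[ℂ] H) k)))
  have h1 : Tendsto (fun n => (x n : H →L[ℂ] H) ((x' n : H →L[ℂ] H) k - (y' : H →L[ℂ] H) k))
      atTop (𝓝 0) := by
    refine squeeze_zero_norm (fun n => ContinuousLinearMap.le_of_opNorm_le _ (hC n) _) ?_
    simpa using ((tendsto_sub_nhds_zero_iff.2 (h' k)).norm.const_mul C)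
  have h2 := h1.add (h ((y' : H →L[ℂ] H) k))
  rw [zero_add] at h2
  refine h2.congr fun n => ?_
  rw [map_sub, sub_add_cancel]

/-- The strong limit of adjoints, provided it exists, is the adjoint of the strong limit. -/
theorem SOTTendsto.star_eq {A : VonNeumannAlgebra H} {x : ℕ → A.toStarSubalgebra}
    {y z : A.toStarSubalgebra} (h : SOTTendsto x y) (h' : SOTTendsto (fun n => star (x n)) z) :
    z = star y := by
  apply Subtype.ext
  ext a
  refine ext_inner_right ℂ fun b => ?_
  refine tendsto_nhds_unique (h'.weak a b) ?_
  change Tendsto (fun n => ⟪ContinuousLinearMap.adjoint (x n : H →L[ℂ] H) a, b⟫_ℂ) _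
    (𝓝 ⟪ContinuousLinearMap.adjoint (y : H →L[ℂ] H) a, b⟫_ℂ)
  simp only [ContinuousLinearMap.adjoint_inner_left]
  exact tendsto_const_nhds.inner (h b)

/-! ### Limits of inner automorphisms -/

variable (π : SInf →* unitary (H →L[ℂ] H))

theorem norm_AdRep_le (s : SInf) (x : Alg π) :
    ‖((AdRep π s x : Alg π) : H →L[ℂ] H)‖ ≤ ‖(x : H →L[ℂ] H)‖ := by
  have h1 : ‖(π s : H →L[ℂ] H)‖ ≤ 1 := by
    -- Only `‖1‖ ≤ 1` is used below, so `H` may be trivial.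
    have h0 := CStarRing.norm_star_mul_self (x := (π s : H →L[ℂ] H))
    rw [Unitary.coe_star_mul_self] at h0
    have h2 : ‖(1 : H →L[ℂ] H)‖ ≤ 1 := ContinuousLinearMap.norm_id_le
    nlinarith [norm_nonneg (π s : H →L[ℂ] H)]
  change ‖(π s : H →L[ℂ] H) * (x : H →L[ℂ] H) * star (π s : H →L[ℂ] H)‖ ≤ _
  calc _ ≤ ‖(π s : H →L[ℂ] H)‖ * ‖(x : H →L[ℂ] H)‖ * ‖star (π s : H →L[ℂ] H)‖ :=
        (norm_mul_le _ _).trans (by gcongr; exact norm_mul_le _ _)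
    _ ≤ 1 * ‖(x : H →L[ℂ] H)‖ * 1 := by
        gcongr
        rwa [norm_star]
    _ = _ := by ring

variable {φ : Alg π →ₗ[ℂ] ℂ}

theorem stateSq_of_starAlgHom {θ : Alg π → Alg π} (hmul : ∀ x y, θ (x * y) = θ x * θ y)
    (hstar : ∀ x, θ (star x) = star (θ x)) (hinv : ∀ x, φ (θ x) = φ x) (x : Alg π) :
    stateSq φ (θ x) = stateSq φ x := by
  rw [stateSq, ← hstar, ← hmul, hinv]
  rfl

theorem stateSq_AdRep (hinv : ∀ s x, φ (AdRep π s x) = φ x) (s : SInf) (x : Alg π) :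
    stateSq φ (AdRep π s x) = stateSq φ x :=
  stateSq_of_starAlgHom π (map_mul (AdRep π s)) (map_star (AdRep π s)) (hinv s) x

/-- An element of the span involves finitely many group elements, and on each of them the conjugates
are eventually stationary. -/
theorem eventually_AdRep_eq {g : ℕ → SInf}
    (hg : ∀ t, ∃ t', ∀ᶠ N in atTop, g N * t * (g N)⁻¹ = t') {m : Alg π} (hm : m ∈ repSpan π) :
    ∃ m', ∀ᶠ N in atTop, AdRep π (g N) m = m' := by
  induction hm using Submodule.span_induction with
  | mem x hx =>
    obtain ⟨t, rfl⟩ := hx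
    obtain ⟨t', h⟩ := hg t
    exact ⟨rep π t', h.mono fun N hN => by rw [AdRep_rep, hN]⟩
  | zero => exact ⟨0, Eventually.of_forall fun N => map_zero _⟩
  | add x y _ _ hx hy =>
    obtain ⟨a, ha⟩ := hx
    obtain ⟨b, hb⟩ := hy
    exact ⟨a + b, ha.mp (hb.mono fun N hb ha => by rw [map_add, ha, hb])⟩
  | smul c x _ hx =>
    obtain ⟨a, ha⟩ := hx
    exact ⟨c • a, ha.mono fun N ha => by rw [map_smul, ha]⟩

/-- Approximate `x` by `m` in the span: the terms for `m` eventually cancel, and those for `x - m`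
stay small because `Ad π` preserves the seminorm. So the differences tend to zero in the seminorm;
being bounded, they tend to zero strongly. -/
theorem exists_SOTTendsto_AdRep (hφ : IsFaithfulNormalState (repAlg π) φ)
    (hinv : ∀ s x, φ (AdRep π s x) = φ x) {g : ℕ → SInf}
    (hg : ∀ t, ∃ t', ∀ᶠ N in atTop, g N * t * (g N)⁻¹ = t') (x : Alg π) :
    ∃ y, SOTTendsto (fun N => AdRep π (g N) x) y := by
  have hq : Tendsto (fun p : ℕ × ℕ => stateSq φ (AdRep π (g p.1) x - AdRep π (g p.2) x)) atTop
      (𝓝 0) := by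
    rw [Metric.tendsto_nhds]
    intro ε hε
    obtain ⟨m, hm, hlt⟩ := hφ.normal.exists_stateSq_sub_lt π x (ε := ε / 4) (by positivity)
    obtain ⟨m', hm'⟩ := eventually_AdRep_eq π hg hm
    rw [← prod_atTop_atTop_eq]
    filter_upwards [hm'.prod_mk hm'] with p hp
    rw [Real.dist_eq, sub_zero, abs_of_nonneg (hφ.stateSq_nonneg _)]
    have e : AdRep π (g p.1) x - AdRep π (g p.2) x
        = AdRep π (g p.1) (x - m) - AdRep π (g p.2) (x - m) := by
      rw [map_sub, map_sub, hp.1, hp.2]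
      abel
    rw [e]
    have h := hφ.stateSq_sub_le (AdRep π (g p.1) (x - m)) (AdRep π (g p.2) (x - m))
    rw [stateSq_AdRep π hinv, stateSq_AdRep π hinv] at h
    linarith
  have hC : ∀ p : ℕ × ℕ, ‖((AdRep π (g p.1) x - AdRep π (g p.2) x : Alg π) : H →L[ℂ] H)‖
      ≤ ‖(x : H →L[ℂ] H)‖ + ‖(x : H →L[ℂ] H)‖ := fun p =>
    (norm_sub_le (AdRep π (g p.1) x : H →L[ℂ] H) (AdRep π (g p.2) x : H →L[ℂ] H)).trans
      (add_le_add (norm_AdRep_le π _ _) (norm_AdRep_le π _ _))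
  have hlim : ∀ h, ∃ k, Tendsto (fun N => ((AdRep π (g N) x : Alg π) : H →L[ℂ] H) h) atTop
      (𝓝 k) := fun h => by
    refine cauchySeq_tendsto_of_complete (cauchySeq_iff_tendsto_dist_atTop_0.2 ?_)
    simp_rw [dist_eq_norm]
    exact tendsto_zero_iff_norm_tendsto_zero.1 (hφ.tendsto_zero_of_stateSq hC hq h)
  choose f hf using hlim
  let T : H →L[ℂ] H := ContinuousLinearMap.ofTendstoOfBoundedRange f
    (fun N => ((AdRep π (g N) x : Alg π) : H →L[ℂ] H)) (tendsto_pi_nhds.2 hf)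
    (isBounded_iff_forall_norm_le.2 ⟨‖(x : H →L[ℂ] H)‖, by
      rintro _ ⟨N, rfl⟩
      exact norm_AdRep_le π _ _⟩)
  exact ⟨⟨T, mem_of_weak_limit (A := repAlg π) (l := atTop) (y := fun N => AdRep π (g N) x)
    fun h k => (hf h).inner tendsto_const_nhds⟩, hf⟩

/-- If conjugation by `g N` is eventually stationary on `S_∞` and `φ` is invariant, then
`Ad π(g N)` converges strongly to a `φ`-preserving endomorphism. -/
theorem exists_limit_endomorphism (hφ : IsFaithfulNormalState (repAlg π) φ)
    (hinv : ∀ s x, φ (AdRep π s x) = φ x) {g : ℕ → SInf} {f : SInf → SInf}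
    (hg : ∀ t, ∀ᶠ N in atTop, g N * t * (g N)⁻¹ = f t) :
    ∃ α : Alg π →⋆ₐ[ℂ] Alg π, (∀ x, SOTTendsto (fun N => AdRep π (g N) x) (α x)) ∧
      (∀ x, φ (α x) = φ x) ∧ ∀ t, α (rep π t) = rep π (f t) := by
  choose α hα using exists_SOTTendsto_AdRep π hφ hinv fun t => ⟨f t, hg t⟩
  have hmul : ∀ x y, α (x * y) = α x * α y := fun x y => by
    refine (hα (x * y)).unique ?_
    simp only [map_mul]
    exact (hα x).mul (fun N => norm_AdRep_le π _ _) (hα y)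
  have hadd : ∀ x y, α (x + y) = α x + α y := fun x y => by
    refine (hα (x + y)).unique ?_
    simp only [map_add]
    exact (hα x).add (hα y)
  have halg : ∀ c : ℂ, α (algebraMap ℂ (Alg π) c) = algebraMap ℂ (Alg π) c := fun c =>
    (hα _).unique (SOTTendsto.of_eventually_eq (Eventually.of_forall fun N =>
      AlgHomClass.commutes (AdRep π (g N)) c))
  refine ⟨{ toFun := α
            map_one' := by simpa using halg 1
            map_mul' := hmul
            map_zero' := by simpa using halg 0
            map_add' := hadd
            commutes' := halg
            -- The strong limit of the adjoints is known to exist from the convergence already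
            -- proved at `star x`.
            map_star' := fun x => (hα x).star_eq (by simpa only [map_star] using hα (star x)) },
    hα, fun x => ?_, fun t => ?_⟩
  · refine tendsto_nhds_unique (hφ.normal.tendsto (fun N => norm_AdRep_le π (g N) x)
      (hα x).weak) ?_
    simp only [hinv]
    exact tendsto_const_nhds
  · exact (hα _).unique (SOTTendsto.of_eventually_eq ((hg t).mono fun N hN => by
      rw [AdRep_rep, hN]))

end LimitEndomorphism

/-! ### Combinatorics of the partial shifts -/

theorem SInf_ext {s t : SInf} (h : ∀ k, (s : Equiv.Perm ℕ) k = (t : Equiv.Perm ℕ) k) : s = t :=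
  Subtype.ext (Equiv.ext h)

theorem SInf_mul_apply (s t : SInf) (k : ℕ) :
    ((s * t : SInf) : Equiv.Perm ℕ) k = (s : Equiv.Perm ℕ) ((t : Equiv.Perm ℕ) k) := rfl

theorem SInf_inv_apply_self (s : SInf) (k : ℕ) :
    ((s⁻¹ : SInf) : Equiv.Perm ℕ) ((s : Equiv.Perm ℕ) k) = k :=
  (s : Equiv.Perm ℕ).symm_apply_apply k

/-- The increasing injection of `ℕ` omitting `n`. -/
def skip (n k : ℕ) : ℕ := if k < n then k else k + 1

theorem eq_or_eq_skip (n j : ℕ) : j = n ∨ ∃ k, j = skip n k := by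
  rcases lt_trichotomy j n with h | h | h
  · exact Or.inr ⟨j, by rw [skip, if_pos h]⟩
  · exact Or.inl h
  · exact Or.inr ⟨j - 1, by rw [skip, if_neg (by omega)]; omega⟩

theorem coxDown_succ (m : ℕ) : coxDown (m + 1) = cox (m + 1) * coxDown m := by
  rw [coxDown, List.range_succ, List.reverse_append, List.reverse_singleton, List.map_append,
    List.prod_append]
  simp [coxDown]

theorem coxDown_apply (m k : ℕ) : (coxDown m : Equiv.Perm ℕ) k =
    if k = 0 then m else if k ≤ m then k - 1 else k := by
  induction m with
  | zero =>
    have : coxDown 0 = 1 := by simp [coxDown, cox_zero]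
    rw [this]
    change k = _
    split_ifs <;> omega
  | succ m ih =>
    rw [coxDown_succ, SInf_mul_apply, ih]
    simp only [cox, Nat.add_sub_cancel, Equiv.swap_apply_def]
    split_ifs <;> omega

theorem coxUp_self (n : ℕ) : coxUp (n + 1) n = 1 := by
  simp [coxUp]

theorem coxUp_succ {n N : ℕ} (h : n ≤ N) :
    coxUp (n + 1) (N + 1) = coxUp (n + 1) N * cox (N + 1) := by
  rw [coxUp, List.Ico.succ_top (by omega), List.map_append, List.prod_append]
  simp [coxUp]

theorem coxUp_apply {n N : ℕ} (h : n ≤ N) (k : ℕ) : (coxUp (n + 1) N : Equiv.Perm ℕ) k =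
    if k < n then k else if k < N then k + 1 else if k = N then n else k := by
  induction N, h using Nat.le_induction generalizing k with
  | base =>
    rw [coxUp_self]
    change k = _
    split_ifs <;> omega
  | succ N hN ih =>
    rw [coxUp_succ hN, SInf_mul_apply, ih]
    simp only [cox, Nat.add_sub_cancel, Equiv.swap_apply_def]
    split_ifs <;> omega

theorem coxUp_mem_SFrom (n N : ℕ) : coxUp n N ∈ SFrom n := by
  refine Subgroup.list_prod_mem _ fun x hx => ?_
  obtain ⟨i, hi, rfl⟩ := List.mem_map.1 hx
  exact Subgroup.subset_closure ⟨i, (List.Ico.mem.1 hi).1, rfl⟩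

theorem sh_iterate_cox (n i : ℕ) (hi : 1 ≤ i) : sh^[n] (cox i) = cox (i + n) := by
  induction n with
  | zero => rfl
  | succ n ih => rw [Function.iterate_succ_apply', ih, sh_cox _ (by omega), add_assoc]

theorem sh_iterate_coxUp (n N : ℕ) : sh^[n] (coxUp 1 N) = coxUp (n + 1) (n + N) := by
  have h : sh^[n] (coxUp 1 N) = ((List.Ico 1 (N + 1)).map fun i => sh^[n] (cox i)).prod := by
    induction n with
    | zero => rfl
    | succ n ih =>
      rw [Function.iterate_succ_apply', ih, map_list_prod, List.map_map]
      simp only [Function.iterate_succ_apply', Function.comp_def]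
  rw [h, coxUp, show n + N + 1 = (N + 1) + n by omega, show n + 1 = 1 + n by omega,
    ← List.Ico.map_add, List.map_map]
  congr 1
  refine List.map_congr_left fun i hi => ?_
  rw [sh_iterate_cox n i (List.Ico.mem.1 hi).1, Function.comp_apply, add_comm]

/-- The cycle `coxDown n` sends `0` to `n` and `k + 1` to `skip n k`, so conjugation by it moves the
fixed point of `sh s` from `0` to `n`. -/
theorem partialSh_apply_self (n : ℕ) (s : SInf) : (partialSh n s : Equiv.Perm ℕ) n = n := by
  have h : (coxDown n : Equiv.Perm ℕ) 0 = n := by simp [coxDown_apply]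
  conv_lhs => rw [← DFunLike.congr_arg (partialSh n s : Equiv.Perm ℕ) h]
  rw [partialSh_apply, ← coxDown_inv, SInf_mul_apply, SInf_inv_apply_self, SInf_mul_apply,
    sh_apply_zero, h]

theorem partialSh_apply_skip (n : ℕ) (s : SInf) (k : ℕ) :
    (partialSh n s : Equiv.Perm ℕ) (skip n k) = skip n ((s : Equiv.Perm ℕ) k) := by
  have h : ∀ k, (coxDown n : Equiv.Perm ℕ) (k + 1) = skip n k := by
    intro k
    rw [coxDown_apply, skip]
    split_ifs <;> first | contradiction | omega
  rw [← h, partialSh_apply, ← coxDown_inv, SInf_mul_apply, SInf_inv_apply_self, SInf_mul_apply,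
    sh_apply_succ, h]

/-- The point `n` and the range of `skip n` exhaust `ℕ`. This criterion reduces every concrete value
of `sh_n` to a case check. -/
theorem partialSh_eq {n : ℕ} {s p : SInf} (hn : (p : Equiv.Perm ℕ) n = n)
    (hp : ∀ k, (p : Equiv.Perm ℕ) (skip n k) = skip n ((s : Equiv.Perm ℕ) k)) :
    partialSh n s = p := by
  refine SInf_ext fun j => ?_
  rcases eq_or_eq_skip n j with rfl | ⟨k, rfl⟩
  · rw [partialSh_apply_self, hn]
  · rw [partialSh_apply_skip, hp]

theorem partialSh_cox (i : ℕ) (hi : 1 ≤ i) : partialSh 0 (cox i) = cox (i + 1) := by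
  refine partialSh_eq ?_ fun k => ?_
  · simp only [cox, Equiv.swap_apply_def, Nat.add_sub_cancel]
    split_ifs <;> first | contradiction | omega
  · simp only [cox, Equiv.swap_apply_def, skip]
    split_ifs <;> omega

theorem partialSh_starGen_of_lt {n i : ℕ} (hn : 1 ≤ n) (h : i < n) :
    partialSh n (starGen i) = starGen i := by
  refine partialSh_eq ?_ fun k => ?_
  · simp only [starGen, Equiv.swap_apply_def]
    split_ifs <;> omega
  · simp only [starGen, Equiv.swap_apply_def, skip]
    split_ifs <;> first | contradiction | omega

theorem partialSh_starGen_of_le {n i : ℕ} (hn : 1 ≤ n) (h : n ≤ i) :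
    partialSh n (starGen i) = starGen (i + 1) := by
  refine partialSh_eq ?_ fun k => ?_
  · simp only [starGen, Equiv.swap_apply_def]
    split_ifs <;> omega
  · simp only [starGen, Equiv.swap_apply_def, skip]
    split_ifs <;> first | contradiction | omega

theorem exists_forall_ge_apply_eq (t : SInf) :
    ∃ M, ∀ k, M ≤ k → (t : Equiv.Perm ℕ) k = k := by
  have ht : {k | (t : Equiv.Perm ℕ) k ≠ k}.Finite := t.2
  obtain ⟨M, hM⟩ := ht.bddAbove
  refine ⟨M + 1, fun k hk => ?_⟩
  by_contra hne
  have := hM hne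
  omega

/-- The cycle `σ_{n+1} ⋯ σ_N` sends `N` to `n` and agrees with `skip n` below `N`. Once `t` fixes
every point from `N` on, conjugation by the cycle therefore has the two properties that characterize
`sh_n t`. -/
theorem eventually_coxUp_conj (n : ℕ) (t : SInf) :
    ∀ᶠ N in atTop, coxUp (n + 1) N * t * (coxUp (n + 1) N)⁻¹ = partialSh n t := by
  obtain ⟨M, hM⟩ := exists_forall_ge_apply_eq t
  filter_upwards [eventually_ge_atTop (n + M)] with N hN
  symm
  have hc := coxUp_apply (show n ≤ N by omega)
  refine partialSh_eq ?_ fun k => ?_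
  · have h : (coxUp (n + 1) N : Equiv.Perm ℕ) N = n := by
      rw [hc]
      split_ifs <;> omega
    conv_lhs => rw [← DFunLike.congr_arg
      ((coxUp (n + 1) N * t * (coxUp (n + 1) N)⁻¹ : SInf) : Equiv.Perm ℕ) h]
    rw [SInf_mul_apply, SInf_inv_apply_self, SInf_mul_apply, hM N (by omega), h]
  · by_cases hk : k < N
    · have h : ∀ k < N, (coxUp (n + 1) N : Equiv.Perm ℕ) k = skip n k := by
        intro k hk
        rw [hc, skip]
        split_ifs <;> omega
      -- If `t k ≥ N`, then `t` fixes `t k`, and injectivity forces `t k = k < N`.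
      have htk : (t : Equiv.Perm ℕ) k < N := by
        by_contra hcon
        have := (t : Equiv.Perm ℕ).injective (hM _ (show M ≤ (t : Equiv.Perm ℕ) k by omega))
        omega
      rw [← h k hk, SInf_mul_apply, SInf_inv_apply_self, SInf_mul_apply, h _ htk]
    · have h : (coxUp (n + 1) N : Equiv.Perm ℕ) (k + 1) = k + 1 := by
        rw [hc]
        split_ifs <;> omega
      have hs : skip n k = k + 1 := by rw [skip, if_neg (by omega)]
      rw [hM k (by omega), hs]
      conv_lhs => rw [← h]
      rw [SInf_mul_apply, SInf_inv_apply_self, SInf_mul_apply, hM (k + 1) (by omega), h]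

/-- Each application of `sh_n` creates the fixed point `n` and pushes the earlier fixed points from
`n` on up by one. -/
theorem partialSh_iterate_apply (n k : ℕ) (s : SInf) (j : ℕ) (hj : n ≤ j) (hj' : j < n + k) :
    ((partialSh n)^[k] s : Equiv.Perm ℕ) j = j := by
  induction k generalizing j with
  | zero => omega
  | succ k ih =>
    rw [Function.iterate_succ_apply']
    rcases eq_or_lt_of_le hj with rfl | h
    · exact partialSh_apply_self _ _
    · have e : j = skip n (j - 1) := by
        rw [skip, if_neg (by omega)]
        omega
      conv_lhs => rw [e]
      rw [partialSh_apply_skip, ih (j - 1) (by omega) (by omega), ← e]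

theorem cox_conj_of_fixed {b : ℕ} {p : SInf} (h1 : (p : Equiv.Perm ℕ) (b - 1) = b - 1)
    (h2 : (p : Equiv.Perm ℕ) b = b) : cox b * p * (cox b)⁻¹ = p := by
  rw [mul_inv_eq_iff_eq_mul]
  apply Subtype.ext
  change Equiv.swap (b - 1) b * (p : Equiv.Perm ℕ) = (p : Equiv.Perm ℕ) * Equiv.swap (b - 1) b
  rw [Equiv.mul_swap_eq_swap_mul, h1, h2]

/-! ### The limit endomorphisms -/

section Limits

variable {H : Type u} [NormedAddCommGroup H] [InnerProductSpace ℂ H] [CompleteSpace H]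
  (π : SInf →* unitary (H →L[ℂ] H)) {φ : Alg π →ₗ[ℂ] ℂ}

theorem AdCox_eq (a b : ℕ) (x : Alg π) : AdCox π a b x = AdRep π (coxUp a b) x := by
  have h : ((List.Ico a (b + 1)).map (coxU π)).prod = rep π (coxUp a b) := by
    rw [coxUp]
    induction List.Ico a (b + 1) with
    | nil => simp [rep_one]
    | cons i l ih => rw [List.map_cons, List.prod_cons, List.map_cons, List.prod_cons, rep_mul, ih,
        coxU]
  rw [AdCox, h, AdRep_apply]

/-- Here `β` is the `k`-th power of `α`; a fixed point of `α` is then exhibited as a value of `β`.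
-/
theorem exists_iterate_endomorphism {α : Alg π →⋆ₐ[ℂ] Alg π} {f : SInf → SInf}
    (hinv : ∀ x, φ (α x) = φ x) (hrep : ∀ t, α (rep π t) = rep π (f t)) (k : ℕ) :
    ∃ β : Alg π →⋆ₐ[ℂ] Alg π, (∀ x, α x = x → β x = x) ∧ (∀ x, φ (β x) = φ x) ∧
      ∀ t, β (rep π t) = rep π (f^[k] t) := by
  induction k with
  | zero => exact ⟨StarAlgHom.id ℂ _, fun _ _ => rfl, fun _ => rfl, fun _ => rfl⟩
  | succ k ih =>
    obtain ⟨β, h1, h2, h3⟩ := ih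
    refine ⟨α.comp β, fun x hx => ?_, fun x => ?_, fun t => ?_⟩
    · rw [StarAlgHom.comp_apply, h1 x hx, hx]
    · rw [StarAlgHom.comp_apply, hinv, h2]
    · rw [StarAlgHom.comp_apply, h3, hrep, Function.iterate_succ_apply']

/-- If `β` preserves `φ` and the image of `π(S_∞)` under `β` is fixed by `Ad π(s)`, then so is the
whole range of `β`. -/
theorem AdRep_eq_of_rep (hφ : IsFaithfulNormalState (repAlg π) φ)
    (hinv : ∀ s x, φ (AdRep π s x) = φ x) {β : Alg π →⋆ₐ[ℂ] Alg π} (hβ : ∀ x, φ (β x) = φ x)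
    {s : SInf} (hs : ∀ t, AdRep π s (β (rep π t)) = β (rep π t)) (x : Alg π) :
    AdRep π s (β x) = β x := by
  rw [← sub_eq_zero]
  refine hφ.eq_zero_of_stateSq _
    (le_antisymm (le_of_forall_pos_le_add fun ε hε => ?_) (hφ.stateSq_nonneg _))
  obtain ⟨m, hm, hlt⟩ := hφ.normal.exists_stateSq_sub_lt π x (ε := ε / 4) (by positivity)
  have hm' : AdRep π s (β m) = β m := by
    clear hlt
    induction hm using Submodule.span_induction with
    | mem x hx =>
      obtain ⟨t, rfl⟩ := hx
      exact hs t
    | zero => simp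
    | add x y _ _ hx hy => rw [map_add, map_add, hx, hy]
    | smul c x _ hx => rw [map_smul, map_smul, hx]
  have e : AdRep π s (β x) - β x = AdRep π s (β (x - m)) - β (x - m) := by
    rw [map_sub, map_sub, hm']
    abel
  have h := hφ.stateSq_sub_le (AdRep π s (β (x - m))) (β (x - m))
  rw [stateSq_AdRep π hinv, stateSq_of_starAlgHom π (map_mul β) (map_star β) hβ] at h
  rw [e]
  linarith

theorem endoFix_eq_fixAlgPred (hφ : IsFaithfulNormalState (repAlg π) φ)
    (hinv : ∀ s x, φ (AdRep π s x) = φ x) {n : ℕ} {α : Alg π →⋆ₐ[ℂ] Alg π}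
    (hlim : ∀ x, SOTTendsto (fun N => AdRep π (coxUp (n + 1) N) x) (α x))
    (hα : ∀ x, φ (α x) = φ x) (hrep : ∀ t, α (rep π t) = rep π (partialSh n t)) :
    endoFix α = fixAlgPred π n := by
  ext x
  rw [mem_fixAlgPred]
  change α x = x ↔ _
  constructor
  · intro hx s hs
    induction hs using Subgroup.closure_induction with
    | mem s hs =>
      obtain ⟨b, hb, rfl⟩ := hs
      -- The power `b + 1` suffices: `sh_n^{b+1}(t)` fixes `n, …, n + b`, which includes `b - 1` and
      -- `b` as `b ≥ n + 1`. So it commutes with `σ_b`.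
      obtain ⟨β, h1, h2, h3⟩ := exists_iterate_endomorphism π hα hrep (b + 1)
      rw [← h1 x hx]
      refine AdRep_eq_of_rep π hφ hinv h2 (fun t => ?_) x
      rw [h3, AdRep_rep, cox_conj_of_fixed] <;>
        exact partialSh_iterate_apply _ _ _ _ (by omega) (by omega)
    | one => rw [map_one]; rfl
    | mul s t _ _ hs ht =>
      rw [map_mul]
      change AdRep π s (AdRep π t x) = x
      rw [ht, hs]
    | inv s _ hs =>
      conv_lhs => rw [← hs]
      rw [map_inv]
      exact (AdRep π s).symm_apply_apply x
  · intro hx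
    -- All conjugating elements lie in `S_{n+1,∞}`, so the sequence defining `α x` is constantly
    -- `x`.
    exact (hlim x).unique (SOTTendsto.of_eventually_eq (Eventually.of_forall fun N =>
      hx _ (coxUp_mem_SFrom _ _)))

end Limits

/-! ### Words in the star generators -/

theorem sh_conj_starGen (s : SInf) (i : ℕ) :
    sh s * starGen (i + 1) * (sh s)⁻¹ = starGen ((s : Equiv.Perm ℕ) i + 1) := by
  rw [mul_inv_eq_iff_eq_mul]
  apply Subtype.ext
  change (sh s : Equiv.Perm ℕ) * Equiv.swap 0 (i + 1)
    = Equiv.swap 0 ((s : Equiv.Perm ℕ) i + 1) * (sh s : Equiv.Perm ℕ)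
  rw [Equiv.mul_swap_eq_swap_mul, sh_apply_zero, sh_apply_succ]

/-- The infinite symmetric group is generated, as a monoid, by the star generators. -/
theorem starGen_induction {p : SInf → Prop} (one : p 1) (mul : ∀ s t, p s → p t → p (s * t))
    (gen : ∀ i, p (starGen (i + 1))) (t : SInf) : p t := by
  have hstar : ∀ i, p (starGen i) := fun i => by
    rcases i with _ | i
    · rwa [starGen_zero]
    · exact gen i
  have hswap : ∀ i j, p ⟨Equiv.swap i j, swap_mem_SInf i j⟩ := by
    intro i j
    by_cases hi : i = 0
    · subst hi
      exact hstar j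
    by_cases hj : j = 0
    · subst hj
      have e : (⟨Equiv.swap i 0, swap_mem_SInf i 0⟩ : SInf) = starGen i :=
        Subtype.ext (Equiv.swap_comm i 0)
      rw [e]
      exact hstar i
    by_cases h : i = j
    · subst h
      have e : (⟨Equiv.swap i i, swap_mem_SInf i i⟩ : SInf) = 1 :=
        Subtype.ext (Equiv.swap_self i)
      rwa [e]
    -- The identity `(i j) = (0 i)(0 j)(0 i)`.
    have e : (⟨Equiv.swap i j, swap_mem_SInf i j⟩ : SInf)
        = starGen i * starGen j * starGen i := by
      refine SInf_ext fun k => ?_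
      change Equiv.swap i j k = Equiv.swap 0 i (Equiv.swap 0 j (Equiv.swap 0 i k))
      simp only [Equiv.swap_apply_def]
      split_ifs <;> first | contradiction | omega
    rw [e]
    exact mul _ _ (mul _ _ (hstar i) (hstar j)) (hstar i)
  have main : ∀ M (t : SInf), (∀ k, M ≤ k → (t : Equiv.Perm ℕ) k = k) → p t := by
    intro M
    induction M with
    | zero =>
      intro t ht
      rwa [show t = 1 from SInf_ext fun k => ht k (Nat.zero_le k)]
    | succ M ih =>
      intro t ht
      -- Multiplying by this transposition makes `M` a fixed point too, which lowers the bound on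
      -- the support.
      set w : SInf := ⟨Equiv.swap ((t : Equiv.Perm ℕ) M) M, swap_mem_SInf _ _⟩
      have hw : w * (w * t) = t := by
        refine SInf_ext fun k => ?_
        exact Equiv.swap_apply_self _ _ _
      rw [← hw]
      refine mul _ _ (hswap _ _) (ih _ fun k hk => ?_)
      change Equiv.swap ((t : Equiv.Perm ℕ) M) M ((t : Equiv.Perm ℕ) k) = k
      rcases eq_or_lt_of_le hk with rfl | hlt
      · exact Equiv.swap_apply_left _ _
      · rw [ht k hlt]
        refine Equiv.swap_apply_of_ne_of_ne (fun h => ?_) (by omega)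
        have := (t : Equiv.Perm ℕ).injective ((ht k hlt).trans h)
        omega
  obtain ⟨M, hM⟩ := exists_forall_ge_apply_eq t
  exact main M t hM

section Equivalences

variable {H : Type u} [NormedAddCommGroup H] [InnerProductSpace ℂ H] [CompleteSpace H]
  (π : SInf →* unitary (H →L[ℂ] H)) {φ : Alg π →ₗ[ℂ] ℂ}

/-! ### Invariance and traciality -/

theorem range_le_autState_iff :
    (AdRep π).range ≤ autState (repAlg π) φ ↔ ∀ s x, φ (AdRep π s x) = φ x :=
  ⟨fun h s => h ⟨s, rfl⟩, by
    rintro h _ ⟨s, rfl⟩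
    exact h s⟩

/-- Invariance evaluated at `y π(s)` reads `φ(π(s) y) = φ(y π(s))`; normality extends this from
`π(s)` to all `x`. -/
theorem isTracial_of_invariant (hφ : IsFaithfulNormalState (repAlg π) φ)
    (hinv : ∀ s x, φ (AdRep π s x) = φ x) : IsTracial (repAlg π) φ := by
  intro x y
  have h := (hφ.normal.mul_left_right 1 y).eq_of_rep π (hφ.normal.mul_left_right y 1)
    (fun s => ?_) x
  · simpa using h
  · have h := hinv s (y * rep π s)
    rw [AdRep_apply, ← mul_assoc, mul_assoc, rep_mul_star_rep, mul_one] at h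
    simpa using h

theorem invariant_of_isTracial (hφ : IsTracial (repAlg π) φ) (s : SInf) (x : Alg π) :
    φ (AdRep π s x) = φ x := by
  rw [AdRep_apply, hφ, ← mul_assoc, star_rep_mul_rep, one_mul]

theorem invariant_of_mem_stateCentralizer {s : SInf}
    (hs : rep π s ∈ stateCentralizer (repAlg π) φ) (x : Alg π) : φ (AdRep π s x) = φ x := by
  rw [AdRep_apply, mul_assoc, hs, mul_assoc, star_rep_mul_rep, mul_one]

/-- Exchangeability of the star generators makes `φ` invariant under the shifted action. -/
theorem invariant_sh_of_exchangeable (hφ : IsFaithfulNormalState (repAlg π) φ)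
    (h : IsExchangeableOps (repAlg π) φ (fun n => starV π (n + 1))) (s : SInf) (x : Alg π) :
    φ (AdRep π (sh s) x) = φ x := by
  obtain ⟨K, _, _, _, _, C, φ₀, ι, a, -, -, hex, ha⟩ := h
  -- Exchangeability is needed only for the constant choice `a_k = a`. The index `i` carries
  -- `v_{i+1}`, so permuting indices by `s` amounts to conjugating by `sh s`.
  have hword : ∀ l : List ℕ, φ (l.map fun i => starV π ((s : Equiv.Perm ℕ) i + 1)).prod
      = φ (l.map fun i => starV π (i + 1)).prod := by
    intro l
    have h := hex s l.length l.get fun _ => a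
    simp only [ha] at h
    have hl : ∀ f : ℕ → Alg π, List.ofFn (fun k => f (l.get k)) = l.map f := fun f => by
      rw [← Function.comp_def, ← List.map_ofFn, List.ofFn_get]
    rw [hl fun i => starV π (i + 1), hl fun i => starV π ((s : Equiv.Perm ℕ) i + 1)] at h
    exact h.symm
  have hgen : ∀ t : SInf, ∃ l : List ℕ, rep π t = (l.map fun i => starV π (i + 1)).prod := by
    refine starGen_induction ⟨[], by simp [rep_one]⟩ ?_ fun i => ⟨[i], by simp [starV]⟩
    rintro t t' ⟨l, hl⟩ ⟨l', hl'⟩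
    exact ⟨l ++ l', by rw [rep_mul, hl, hl', List.map_append, List.prod_append]⟩
  have h := (hφ.normal.mul_left_right (rep π (sh s)) (star (rep π (sh s)))).eq_of_rep π hφ.normal
    (fun t => ?_) x
  · rw [AdRep_apply, mul_assoc]
    exact h
  · change φ (rep π (sh s) * (rep π t * star (rep π (sh s)))) = φ (rep π t)
    obtain ⟨l, hl⟩ := hgen t
    rw [← mul_assoc, ← AdRep_apply, hl, map_list_prod, List.map_map, ← hword]
    congr 3
    funext i
    rw [Function.comp_apply, starV, AdRep_rep, sh_conj_starGen, starV]

/-- Since `γ_{i+1} = sh(γ_i) γ_1 sh(γ_i)⁻¹`, invariance under the shifted group and under `Ad v_1`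
reaches all star generators, hence the whole group. -/
theorem invariant_of_exchangeable (hφ : IsFaithfulNormalState (repAlg π) φ)
    (h : IsExchangeableOps (repAlg π) φ (fun n => starV π (n + 1)))
    (h1 : starV π 1 ∈ stateCentralizer (repAlg π) φ) (s : SInf) :
    ∀ x : Alg π, φ (AdRep π s x) = φ x := by
  have hsh := invariant_sh_of_exchangeable π hφ h
  refine starGen_induction (p := fun s => ∀ x : Alg π, φ (AdRep π s x) = φ x)
    (fun x => by rw [map_one]; rfl) (fun s t hs ht x => ?_) (fun i x => ?_) s
  · rw [map_mul]
    exact (hs _).trans (ht x)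
  · have e : starGen (i + 1) = sh (starGen i) * (starGen 1 * sh (starGen i)⁻¹) := by
      have h0 := sh_conj_starGen (starGen i) 0
      rw [show (starGen i : Equiv.Perm ℕ) 0 = i from Equiv.swap_apply_left 0 i] at h0
      rw [← h0, map_inv, mul_assoc]
    rw [e, map_mul, map_mul]
    exact (hsh _ _).trans ((invariant_of_mem_stateCentralizer π h1 _).trans (hsh _ _))

end Equivalences

/-! ### The von Neumann algebra generated by a symmetry -/

section Symmetry

variable {H : Type u} [NormedAddCommGroup H] [InnerProductSpace ℂ H] [CompleteSpace H]

/-- An operator commuting with every operator that commutes with a projection `p` acts on the range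
of `p` as a scalar. -/
theorem exists_mul_eq_smul {p x : H →L[ℂ] H} (hp : p * p = p) (hsa : star p = p)
    (hx : ∀ g : H →L[ℂ] H, g * p = p * g → g * x = x * g) : ∃ a : ℂ, x * p = a • p := by
  by_cases h0 : ∀ ξ, p ξ = 0
  · refine ⟨0, ?_⟩
    ext ξ
    simp [h0]
  · push Not at h0
    obtain ⟨ζ, hζ⟩ := h0
    set ξ := p ζ
    have hpp : ∀ h, p (p h) = p h := fun h => DFunLike.congr_fun hp h
    have hin : ∀ h, ⟪ξ, p h⟫_ℂ = ⟪ξ, h⟫_ℂ := fun h => by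
      rw [← ContinuousLinearMap.adjoint_inner_left, ← ContinuousLinearMap.star_eq_adjoint, hsa,
        hpp]
    have hne : ⟪ξ, ξ⟫_ℂ ≠ 0 := inner_self_ne_zero.2 hζ
    refine ⟨⟪ξ, x ξ⟫_ℂ / ⟪ξ, ξ⟫_ℂ, ?_⟩
    ext h
    -- The rank-one operator `k ↦ ⟪ξ, k⟫ p h` commutes with `p`, hence with `x`; evaluating at `ξ`
    -- identifies the scalar.
    have hg := DFunLike.congr_fun (hx ((innerSL ℂ ξ).smulRight (p h)) (by
      ext k
      change ⟪ξ, p k⟫_ℂ • p h = p (⟪ξ, k⟫_ℂ • p h)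
      rw [hin, map_smul, hpp])) ξ
    change ⟪ξ, x ξ⟫_ℂ • p h = x (⟪ξ, ξ⟫_ℂ • p h) at hg
    rw [map_smul] at hg
    change x (p h) = (⟪ξ, x ξ⟫_ℂ / ⟪ξ, ξ⟫_ℂ) • p h
    rw [div_eq_inv_mul, mul_smul, hg, smul_smul, inv_mul_cancel₀ hne, one_smul]

/-- On the range of each spectral projection `(1 ± v)/2` an element of the bicommutant is a scalar,
and the two projections sum to `1`. -/
theorem mem_vN_symmetry {v : H →L[ℂ] H} (hv : v * v = 1) (hsa : star v = v) (x : H →L[ℂ] H) :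
    x ∈ (vN {v}).toStarSubalgebra ↔ ∃ a b : ℂ, x = a • (1 : H →L[ℂ] H) + b • v := by
  constructor
  · intro hx
    have hcomm : ∀ g : H →L[ℂ] H, g * v = v * g → g * x = x * g := fun g hg =>
      comm_of_mem_vN hx (by simpa using hg) (by simpa [hsa] using hg)
    have key : ∀ ε : ℂ, ε * ε = 1 → star ε = ε →
        ∃ a : ℂ, x * ((1 / 2 : ℂ) • (1 + ε • v)) = a • ((1 / 2 : ℂ) • (1 + ε • v)) := by
      intro ε hε hε'
      refine exists_mul_eq_smul ?_ ?_ fun g hg => hcomm g ?_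
      · simp only [smul_mul_assoc, mul_smul_comm, mul_add, add_mul, mul_one, one_mul, hv]
        trans (1 / 4 : ℂ) • (1 : H →L[ℂ] H) + (ε / 2) • v + (1 / 4 : ℂ) • (ε * ε) • (1 : H →L[ℂ] H)
        · module
        · rw [hε]
          module
      · rw [star_smul, star_add, star_smul, star_one, hsa, hε']
        simp
      · simp only [smul_mul_assoc, mul_smul_comm, mul_add, add_mul, mul_one, one_mul] at hg
        have h2 : ε • (g * v) = ε • (v * g) :=
          add_left_cancel (smul_right_injective _ (one_div_ne_zero (two_ne_zero (α := ℂ))) hg)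
        have hε0 : ε ≠ 0 := by
          rintro rfl
          simp at hε
        exact smul_right_injective _ hε0 h2
    obtain ⟨a, ha⟩ := key 1 (by simp) (by simp)
    obtain ⟨b, hb⟩ := key (-1) (by simp) (by simp)
    refine ⟨(a + b) / 2, (a - b) / 2, ?_⟩
    have e : x = x * ((1 / 2 : ℂ) • (1 + (1 : ℂ) • v)) + x * ((1 / 2 : ℂ) • (1 + (-1 : ℂ) • v)) := by
      simp only [mul_smul_comm, mul_add, mul_one]
      module
    rw [e, ha, hb]
    module
  · rintro ⟨a, b, rfl⟩
    have hvm : v ∈ (vN {v}).toStarSubalgebra := subset_vN _ rfl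
    generalize (vN {v}).toStarSubalgebra = S at hvm
    exact S.add_mem (S.smul_mem S.one_mem a) (S.smul_mem hvm b)

/-! ### The conditional expectation onto the span of two complementary projections. -/

section Compression

variable {R : Type*} [Ring R] [Algebra ℂ R]

/-- The map `x ↦ φ(pxp)/φ(p) p + φ(qxq)/φ(q) q`. -/
noncomputable def compression (φ : R →ₗ[ℂ] ℂ) (p q : R) : R →ₗ[ℂ] R where
  toFun x := (φ (p * x * p) / φ p) • p + (φ (q * x * q) / φ q) • q
  map_add' x y := by
    simp only [mul_add, add_mul, map_add, add_div, add_smul]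
    abel
  map_smul' c x := by
    simp only [mul_smul_comm, smul_mul_assoc, map_smul, smul_eq_mul, mul_div_assoc,
      mul_smul, RingHom.id_apply, smul_add]

theorem compression_apply (φ : R →ₗ[ℂ] ℂ) (p q x : R) :
    compression φ p q x = (φ (p * x * p) / φ p) • p + (φ (q * x * q) / φ q) • q := rfl

variable {φ : R →ₗ[ℂ] ℂ} {p q : R} (hpp : p * p = p) (hqq : q * q = q) (hpq : p * q = 0)
  (hqp : q * p = 0)
include hpp hqq hpq hqp

theorem compression_eq_self (hp : φ p = 0 → p = 0) (hq : φ q = 0 → q = 0) (β γ : ℂ) :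
    compression φ p q (β • p + γ • q) = β • p + γ • q := by
  -- When `φ e = 0` the quotient takes a default value, which is harmless since then `e = 0`.
  have hcoef : ∀ e : R, (φ e = 0 → e = 0) → ∀ c : ℂ, (c * φ e / φ e) • e = c • e := by
    intro e he c
    by_cases h0 : φ e = 0
    · rw [he h0, smul_zero, smul_zero]
    · rw [mul_div_assoc, div_self h0, mul_one]
  have e1 : p * (β • p + γ • q) * p = β • p := by
    simp [mul_add, hpp, hpq]
  have e2 : q * (β • p + γ • q) * q = γ • q := by
    simp [mul_add, hqq, hqp]
  rw [compression_apply, e1, e2, map_smul, map_smul, smul_eq_mul, smul_eq_mul, hcoef p hp,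
    hcoef q hq]

theorem compression_bimodule (β γ β' γ' : ℂ) (x : R) :
    compression φ p q ((β • p + γ • q) * x * (β' • p + γ' • q))
      = (β • p + γ • q) * compression φ p q x * (β' • p + γ' • q) := by
  have e1 : p * ((β • p + γ • q) * x * (β' • p + γ' • q)) * p = (β * β') • (p * x * p) := by
    have h1 : p * (β • p + γ • q) = β • p := by simp [mul_add, hpp, hpq]
    have h2 : (β' • p + γ' • q) * p = β' • p := by simp [add_mul, hpp, hqp]
    calc _ = (p * (β • p + γ • q)) * x * ((β' • p + γ' • q) * p) := by simp only [mul_assoc]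
      _ = _ := by
        rw [h1, h2]
        simp only [smul_mul_assoc, mul_smul_comm, smul_smul, mul_comm β]
  have e2 : q * ((β • p + γ • q) * x * (β' • p + γ' • q)) * q = (γ * γ') • (q * x * q) := by
    have h1 : q * (β • p + γ • q) = γ • q := by simp [mul_add, hqq, hqp]
    have h2 : (β' • p + γ' • q) * q = γ' • q := by simp [add_mul, hqq, hpq]
    calc _ = (q * (β • p + γ • q)) * x * ((β' • p + γ' • q) * q) := by simp only [mul_assoc]
      _ = _ := by
        rw [h1, h2]
        simp only [smul_mul_assoc, mul_smul_comm, smul_smul, mul_comm γ]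
  rw [compression_apply, compression_apply, e1, e2, map_smul, map_smul, smul_eq_mul, smul_eq_mul]
  simp only [mul_add, add_mul, smul_mul_assoc, mul_smul_comm, hpp, hqq, hpq, hqp, smul_zero,
    add_zero, zero_add, smul_smul]
  congr 2 <;> ring

omit hpq hqp in
-- The trace property gives `φ(pxp) = φ(px)` and `φ(qxq) = φ(qx)`, which add up to `φ(x)`.
theorem map_compression (htr : ∀ x y, φ (x * y) = φ (y * x)) (hsum : p + q = 1)
    (hp : φ p = 0 → p = 0) (hq : φ q = 0 → q = 0) (x : R) : φ (compression φ p q x) = φ x := by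
  have hstate : ∀ e : R, (φ e = 0 → e = 0) → φ (e * x * e) / φ e * φ e = φ (e * x * e) := by
    intro e he
    by_cases h0 : φ e = 0
    · simp [he h0]
    · rw [div_mul_cancel₀ _ h0]
  rw [compression_apply, map_add, map_smul, map_smul, smul_eq_mul, smul_eq_mul, hstate p hp,
    hstate q hq, htr (p * x) p, htr (q * x) q, ← mul_assoc, ← mul_assoc, hpp, hqq, ← map_add,
    ← add_mul, hsum, one_mul]

end Compression

/-- For a tracial state, the two-dimensional algebra spanned by `1` and a symmetry `v` is the range
of a state-preserving conditional expectation. -/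
theorem isConditioned_vN_symmetry {A : VonNeumannAlgebra H} {φ : A.toStarSubalgebra →ₗ[ℂ] ℂ}
    (hφ : IsFaithfulNormalState A φ) (htr : IsTracial A φ) {v : A.toStarSubalgebra}
    (hv : v * v = 1) (hsa : star v = v) : IsConditioned A φ (vN {(v : H →L[ℂ] H)}) := by
  have hmem : ∀ x : H →L[ℂ] H, x ∈ vN {(v : H →L[ℂ] H)} ↔
      ∃ a b : ℂ, x = a • (1 : H →L[ℂ] H) + b • (v : H →L[ℂ] H) :=
    mem_vN_symmetry (congrArg Subtype.val hv) (congrArg Subtype.val hsa)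
  set p : A.toStarSubalgebra := (1 / 2 : ℂ) • (1 + v) with hpdef
  set q : A.toStarSubalgebra := (1 / 2 : ℂ) • (1 - v) with hqdef
  have hpp : p * p = p := by
    simp only [hpdef, smul_mul_assoc, mul_smul_comm, mul_add, add_mul, mul_one, one_mul, hv]
    module
  have hqq : q * q = q := by
    simp only [hqdef, smul_mul_assoc, mul_smul_comm, mul_sub, sub_mul, mul_one, one_mul, hv]
    module
  have hpq : p * q = 0 := by
    simp only [hpdef, hqdef, smul_mul_assoc, mul_smul_comm, mul_sub, add_mul, mul_one, one_mul, hv]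
    module
  have hqp : q * p = 0 := by
    simp only [hpdef, hqdef, smul_mul_assoc, mul_smul_comm, mul_add, sub_mul, mul_one, one_mul, hv]
    module
  have hsum : p + q = 1 := by
    rw [hpdef, hqdef]
    module
  have hps : star p = p := by
    rw [hpdef, star_smul, star_add, star_one, hsa]
    simp
  have hqs : star q = q := by
    rw [hqdef, star_smul, star_sub, star_one, hsa]
    simp
  have hdecomp : ∀ b : A.toStarSubalgebra, (b : H →L[ℂ] H) ∈ vN {(v : H →L[ℂ] H)} →
      ∃ β γ : ℂ, b = β • p + γ • q := by
    intro b hb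
    obtain ⟨β, γ, h⟩ := (hmem _).1 hb
    have h' : b = β • (1 : A.toStarSubalgebra) + γ • v := Subtype.ext h
    -- Change of basis by `1 = p + q` and `v = p - q`.
    refine ⟨β + γ, β - γ, ?_⟩
    rw [h', hpdef, hqdef]
    module
  have hmem' : ∀ β γ : ℂ, ((β • p + γ • q : A.toStarSubalgebra) : H →L[ℂ] H)
      ∈ vN {(v : H →L[ℂ] H)} := by
    intro β γ
    refine (hmem _).2 ⟨(β + γ) / 2, (β - γ) / 2, ?_⟩
    have h' : β • p + γ • q = ((β + γ) / 2) • (1 : A.toStarSubalgebra) + ((β - γ) / 2) • v := by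
      rw [hpdef, hqdef]
      module
    exact congrArg Subtype.val h'
  have hfaith : ∀ e : A.toStarSubalgebra, star e = e → e * e = e → φ e = 0 → e = 0 :=
    fun e he hee h0 => hφ.faithful e (by rw [he, hee, h0])
  have hpos : ∀ e : A.toStarSubalgebra, star e = e → e * e = e → ∀ x,
      (((φ (e * (star x * x) * e) / φ e) • e : A.toStarSubalgebra) : H →L[ℂ] H).IsPositive := by
    intro e he hee x
    have h1 : 0 ≤ φ e := by
      have := hφ.nonneg e
      rwa [he, hee] at this
    have h2 : 0 ≤ φ (e * (star x * x) * e) := by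
      have := hφ.nonneg (x * e)
      rwa [star_mul, he, mul_assoc, ← mul_assoc (star x), ← mul_assoc] at this
    have h3 : (e : H →L[ℂ] H).IsPositive := by
      have := ContinuousLinearMap.isPositive_adjoint_comp_self (e : H →L[ℂ] H)
      have e1 : (ContinuousLinearMap.adjoint (e : H →L[ℂ] H)).comp (e : H →L[ℂ] H)
          = (e : H →L[ℂ] H) := congrArg Subtype.val (show star e * e = e by rw [he, hee])
      rwa [e1] at this
    exact h3.smul_of_nonneg (div_nonneg h2 h1)
  refine ⟨fun x hx => ?_, ?_⟩
  · obtain ⟨a, b, rfl⟩ := (hmem x).1 hx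
    exact (a • (1 : A.toStarSubalgebra) + b • v).2
  refine ⟨compression φ p q, fun x => hmem' _ _, fun b hb => ?_, fun b x c hb hc => ?_, fun x => ?_,
    map_compression hpp hqq htr hsum (hfaith p hps hpp) (hfaith q hqs hqq)⟩
  · obtain ⟨β, γ, rfl⟩ := hdecomp b hb
    exact compression_eq_self hpp hqq hpq hqp (hfaith p hps hpp) (hfaith q hqs hqq) β γ
  · obtain ⟨β, γ, rfl⟩ := hdecomp b hb
    obtain ⟨β', γ', rfl⟩ := hdecomp c hc
    exact compression_bimodule hpp hqq hpq hqp β γ β' γ' x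
  · change 0 ≤ (((φ (p * (star x * x) * p) / φ p) • p : A.toStarSubalgebra) : H →L[ℂ] H)
      + (((φ (q * (star x * x) * q) / φ q) • q : A.toStarSubalgebra) : H →L[ℂ] H)
    rw [ContinuousLinearMap.nonneg_iff_isPositive]
    exact (hpos p hps hpp x).add (hpos q hqs hqq x)

end Symmetry

/-! ### Exchangeability of the star generators for a trace. -/

section Exchangeable

variable {H : Type u} [NormedAddCommGroup H] [InnerProductSpace ℂ H] [CompleteSpace H]
  (π : SInf →* unitary (H →L[ℂ] H)) {φ : Alg π →ₗ[ℂ] ℂ}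

theorem starV_mul_self (i : ℕ) : starV π i * starV π i = 1 := by
  rw [starV, ← rep_mul, show starGen i * starGen i = 1 from Subtype.ext (Equiv.swap_mul_self 0 i),
    rep_one]

theorem star_starV (i : ℕ) : star (starV π i) = starV π i := by
  rw [starV, star_rep, show (starGen i)⁻¹ = starGen i from Subtype.ext (Equiv.swap_inv 0 i)]

theorem mem_vN_starV (i : ℕ) (x : H →L[ℂ] H) :
    x ∈ (vN {(starV π i : H →L[ℂ] H)}).toStarSubalgebra ↔
      ∃ a b : ℂ, x = a • (1 : H →L[ℂ] H) + b • (starV π i : H →L[ℂ] H) :=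
  mem_vN_symmetry (congrArg Subtype.val (starV_mul_self π i))
    (congrArg Subtype.val (star_starV π i)) x

/-- The algebra `C` generated by `v_1`. -/
noncomputable abbrev starAlg : VonNeumannAlgebra H := vN {(starV π 1 : H →L[ℂ] H)}

theorem starAlg_le : (starAlg π).toStarSubalgebra ≤ (repAlg π).toStarSubalgebra := by
  intro x hx
  obtain ⟨a, b, rfl⟩ := (mem_vN_starV π 1 x).1 hx
  exact (a • (1 : Alg π) + b • starV π 1).2

/-- The inclusion of `C` into `A`. -/
noncomputable def starIncl : (starAlg π).toStarSubalgebra →⋆ₐ[ℂ] Alg π :=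
  StarSubalgebra.inclusion (starAlg_le π)

/-- The random sequence sending `v_1` to `v_{n+1}`. -/
noncomputable def starVar (n : ℕ) : (starAlg π).toStarSubalgebra →⋆ₐ[ℂ] Alg π :=
  (AdRep π (sh (starGen n)) : Alg π →⋆ₐ[ℂ] Alg π).comp (starIncl π)

theorem AdRep_sh_starV (s : SInf) (i : ℕ) :
    AdRep π (sh s) (starV π (i + 1)) = starV π ((s : Equiv.Perm ℕ) i + 1) := by
  rw [starV, AdRep_rep, sh_conj_starGen, starV]

/-- The coefficients do not depend on `n`, so identities about the random variables reduce to
identities about the `v_i`. -/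
theorem exists_starVar_eq (c : (starAlg π).toStarSubalgebra) :
    ∃ a b : ℂ, (c : H →L[ℂ] H) = a • (1 : H →L[ℂ] H) + b • (starV π 1 : H →L[ℂ] H) ∧
      ∀ n, starVar π n c = a • (1 : Alg π) + b • starV π (n + 1) := by
  obtain ⟨a, b, h⟩ := (mem_vN_starV π 1 c).1 c.2
  refine ⟨a, b, h, fun n => ?_⟩
  have h' : starIncl π c = a • (1 : Alg π) + b • starV π (0 + 1) := Subtype.ext h
  change AdRep π (sh (starGen n)) (starIncl π c) = _
  rw [h', map_add, map_smul, map_smul, map_one, AdRep_sh_starV,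
    show (starGen n : Equiv.Perm ℕ) 0 = n from Equiv.swap_apply_left 0 n]

/-- Permutations of the random variables are implemented by inner automorphisms, so invariance of
`φ` is all that exchangeability requires. -/
theorem AdRep_sh_starVar (s : SInf) (n : ℕ) (c : (starAlg π).toStarSubalgebra) :
    AdRep π (sh s) (starVar π n c) = starVar π ((s : Equiv.Perm ℕ) n) c := by
  obtain ⟨a, b, -, h⟩ := exists_starVar_eq π c
  rw [h, h, map_add, map_smul, map_smul, map_one, AdRep_sh_starV]

theorem range_starVar (n : ℕ) :
    ((vN {(starV π (n + 1) : H →L[ℂ] H)} : VonNeumannAlgebra H) : Set (H →L[ℂ] H))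
      = Set.range fun c => (starVar π n c : H →L[ℂ] H) := by
  ext x
  change x ∈ (vN {(starV π (n + 1) : H →L[ℂ] H)}).toStarSubalgebra ↔ _
  rw [mem_vN_starV]
  constructor
  · rintro ⟨a, b, rfl⟩
    refine ⟨⟨a • (1 : H →L[ℂ] H) + b • (starV π 1 : H →L[ℂ] H), (mem_vN_starV π 1 _).2
      ⟨a, b, rfl⟩⟩, ?_⟩
    have h' : starIncl π ⟨a • (1 : H →L[ℂ] H) + b • (starV π 1 : H →L[ℂ] H),
      (mem_vN_starV π 1 _).2 ⟨a, b, rfl⟩⟩ = a • (1 : Alg π) + b • starV π (0 + 1) := rfl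
    change ((AdRep π (sh (starGen n)) (starIncl π _) : Alg π) : H →L[ℂ] H) = _
    rw [h', map_add, map_smul, map_smul, map_one, AdRep_sh_starV,
      show (starGen n : Equiv.Perm ℕ) 0 = n from Equiv.swap_apply_left 0 n]
    rfl
  · rintro ⟨c, rfl⟩
    obtain ⟨a, b, -, h⟩ := exists_starVar_eq π c
    refine ⟨a, b, ?_⟩
    simp only [h]
    rfl

/-- For a tracial state the represented star generators form an exchangeable sequence. -/
theorem isExchangeableOps_starV [TopologicalSpace.SeparableSpace H]
    (hφ : IsFaithfulNormalState (repAlg π) φ) (htr : IsTracial (repAlg π) φ) :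
    IsExchangeableOps (repAlg π) φ (fun n => starV π (n + 1)) := by
  have hinv := invariant_of_isTracial π htr
  -- The probability space is the algebra of `v_1` acting on `H` itself, with the restriction of
  -- `φ`.
  refine ⟨H, inferInstance, inferInstance, inferInstance, inferInstance, starAlg π,
    φ ∘ₗ (starIncl π).toAlgHom.toLinearMap, starVar π,
    ⟨starV π 1, subset_vN _ rfl⟩, ⟨?_, fun x => ?_, fun x hx => ?_, ?_⟩, fun n => ⟨?_, fun c => ?_,
      vN {(starV π (n + 1) : H →L[ℂ] H)}, range_starVar π n,
      isConditioned_vN_symmetry hφ htr (starV_mul_self π _) (star_starV π _)⟩,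
    fun s n i a => ?_, fun n => ?_⟩
  · exact hφ.map_one
  · exact hφ.nonneg (starIncl π x)
  · exact Subtype.ext (congrArg (fun y : Alg π => (y : H →L[ℂ] H)) (hφ.faithful (starIncl π x) hx))
  · obtain ⟨ξ, η, hξ, hη, h⟩ := hφ.normal
    exact ⟨ξ, η, hξ, hη, fun x => h (starIncl π x)⟩
  · exact (AdRep π (sh (starGen n))).injective.comp
      (Set.inclusion_injective (starAlg_le π))
  · exact (hinv _ _).symm
  · rw [← hinv (sh s), map_list_prod, List.map_ofFn]
    simp only [Function.comp_def, AdRep_sh_starVar]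
  · change AdRep π (sh (starGen n)) (starV π (0 + 1)) = _
    rw [AdRep_sh_starV, show (starGen n : Equiv.Perm ℕ) 0 = n from Equiv.swap_apply_left 0 n]

end Exchangeable

/-! ### The limit endomorphisms -/

section Main

variable {H : Type u} [NormedAddCommGroup H] [InnerProductSpace ℂ H] [CompleteSpace H]
  (π : SInf →* unitary (H →L[ℂ] H)) {φ : Alg π →ₗ[ℂ] ℂ}

theorem exists_limit_endomorphisms (hφ : IsFaithfulNormalState (repAlg π) φ)
    (hinv : ∀ s x, φ (AdRep π s x) = φ x) :
    ∃ α : ℕ → (Alg π →⋆ₐ[ℂ] Alg π),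
      (∀ n x, SOTTendsto (fun N => AdRep π ((sh^[n]) (coxUp 1 N)) x) (α n x)) ∧
      (∀ n x, SOTTendsto (fun N => AdCox π (n + 1) N x) (α n x)) ∧
      (∀ n x, φ (α n x) = φ x) ∧
      (∀ n, endoFix (α n) = fixAlgPred π n) ∧
      (∀ n s, α n (rep π s) = rep π (partialSh n s)) ∧
      (∀ i, 1 ≤ i → α 0 (coxU π i) = coxU π (i + 1)) ∧
      (∀ n i, 1 ≤ n → 1 ≤ i → i < n → α n (starV π i) = starV π i) ∧
      (∀ n i, 1 ≤ n → 1 ≤ i → n ≤ i → α n (starV π i) = starV π (i + 1)) := by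
  choose α hlim hα hrep using fun n =>
    exists_limit_endomorphism π hφ hinv (eventually_coxUp_conj n)
  refine ⟨α, fun n x h => ?_, fun n x => ?_, hα,
    fun n => endoFix_eq_fixAlgPred π hφ hinv (hlim n) (hα n) (hrep n), hrep, fun i hi => ?_,
    fun n i hn _ h => ?_, fun n i hn _ h => ?_⟩
  · simp only [sh_iterate_coxUp]
    -- `sh^n(σ_1 ⋯ σ_N)` is `σ_{n+1} ⋯ σ_{n+N}`, so this sequence is the previous one reindexed by
    -- `N ↦ n + N`.
    exact (hlim n x h).comp (tendsto_atTop_mono (fun N => Nat.le_add_left N n) tendsto_id)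
  · simp only [AdCox_eq]
    exact hlim n x
  · rw [coxU, hrep, partialSh_cox i hi, coxU]
  · rw [starV, hrep, partialSh_starGen_of_lt hn h]
  · rw [starV, hrep, partialSh_starGen_of_le hn h, starV]

end Main

end InfSym

theorem mainTheorem12 {H : Type*} [NormedAddCommGroup H] [InnerProductSpace ℂ H] [CompleteSpace H]
    [TopologicalSpace.SeparableSpace H]
    (π : InfSym.SInf →* unitary (H →L[ℂ] H))
    (φ : InfSym.Alg π →ₗ[ℂ] ℂ)
    (hφ : InfSym.IsFaithfulNormalState (InfSym.repAlg π) φ) :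
    List.TFAE [
      (InfSym.AdRep π).range ≤ InfSym.autState (InfSym.repAlg π) φ,
      InfSym.IsTracial (InfSym.repAlg π) φ,
      InfSym.IsExchangeableOps (InfSym.repAlg π) φ (fun n => InfSym.starV π (n + 1)) ∧
        InfSym.starV π 1 ∈ InfSym.stateCentralizer (InfSym.repAlg π) φ] ∧
    (((InfSym.AdRep π).range ≤ InfSym.autState (InfSym.repAlg π) φ ∨
      InfSym.IsTracial (InfSym.repAlg π) φ ∨
      (InfSym.IsExchangeableOps (InfSym.repAlg π) φ (fun n => InfSym.starV π (n + 1)) ∧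
        InfSym.starV π 1 ∈ InfSym.stateCentralizer (InfSym.repAlg π) φ)) →
      ∃ α : ℕ → (InfSym.Alg π →⋆ₐ[ℂ] InfSym.Alg π),
        (∀ n x, InfSym.SOTTendsto
          (fun N => InfSym.AdRep π ((InfSym.sh^[n]) (InfSym.coxUp 1 N)) x) (α n x)) ∧
        (∀ n x, InfSym.SOTTendsto (fun N => InfSym.AdCox π (n + 1) N x) (α n x)) ∧
        (∀ n x, φ (α n x) = φ x) ∧
        (∀ n, InfSym.endoFix (α n) = InfSym.fixAlgPred π n) ∧
        (∀ n s, α n (InfSym.rep π s) = InfSym.rep π (InfSym.partialSh n s)) ∧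
        (∀ i, 1 ≤ i → α 0 (InfSym.coxU π i) = InfSym.coxU π (i + 1)) ∧
        (∀ n i, 1 ≤ n → 1 ≤ i → i < n → α n (InfSym.starV π i) = InfSym.starV π i) ∧
        (∀ n i, 1 ≤ n → 1 ≤ i → n ≤ i → α n (InfSym.starV π i) = InfSym.starV π (i + 1))) := by
  have hb : InfSym.IsTracial (InfSym.repAlg π) φ → ∀ s x, φ (InfSym.AdRep π s x) = φ x :=
    InfSym.invariant_of_isTracial π
  have hc : (InfSym.IsExchangeableOps (InfSym.repAlg π) φ (fun n => InfSym.starV π (n + 1)) ∧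
        InfSym.starV π 1 ∈ InfSym.stateCentralizer (InfSym.repAlg π) φ) →
      ∀ s x, φ (InfSym.AdRep π s x) = φ x :=
    fun h => InfSym.invariant_of_exchangeable π hφ h.1 h.2
  refine ⟨?_, fun h => InfSym.exists_limit_endomorphisms π hφ ?_⟩
  · tfae_have 1 → 2 := fun h =>
      InfSym.isTracial_of_invariant π hφ ((InfSym.range_le_autState_iff π).1 h)
    tfae_have 2 → 3 := fun h => ⟨InfSym.isExchangeableOps_starV π hφ h, h _⟩
    tfae_have 3 → 1 := fun h => (InfSym.range_le_autState_iff π).2 (hc h)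
    tfae_finish
  · rcases h with h | h | h
    · exact (InfSym.range_le_autState_iff π).1 h
    · exact hb h
    · exact hc h
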